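/- Let $\mathbb{F}$ be a field of characteristic $0$. An associative interchange algebra over $\mathbb{F}$ is a vector space with two bilinear associative operations $\circ$ and $\bullet$ satisfying the interchange identity $(a \circ b) \bullet (c \circ d) = (a \bullet c) \circ (b \bullet d)$. Let $A$ be the free associative interchange algebra over $\mathbb{F}$ on countably many generators, with the two Lie brackets \[ [a,b]_\circ = a \circ b - b \circ a, \qquad [a,b]_\bullet = a \bullet b - b \bullet a . \] Let $n \le 5$, and let $f$ be a multilinear nonassociative polynomial of degree $n$ over $\mathbb{F}$ in two binary operation symbols, that is, a linear combination of nonassociative monomials in each of which every one of the indeterminates $x_1, \dots, x_n$ occurs exactly once and no other indeterminate occurs. Suppose that $f$ vanishes under every substitution of elements of $A$ for the indeterminates, when the two operation symbols are interpreted as $[-,-]_\circ$ and $[-,-]_\bullet$. Then $f$ is a consequence of anticommutativity $[a,b]_\ast + [b,a]_\ast \equiv 0$ and the Jacobi identity $[a,[b,c]_\ast]_\ast + [b,[c,a]_\ast]_\ast + [c,[a,b]_\ast]_\ast \equiv 0$ for $\ast \in \{\circ, \bullet\}$: it can be obtained from these identities by substituting nonassociative polynomials for the indeterminates, multiplying on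 either side by nonassociative polynomials using either operation symbol, and forming linear combinations. -/

import Mathlib

namespace Interchange

/-- The two binary operation symbols. -/
inductive Op : Type
  | circ
  | bullet

/-- Nonassociative monomials in the indeterminates `X` with two binary operation symbols. -/
inductive Monomial (X : Type*) : Type _
  | var (x : X) : Monomial X
  | op (o : Op) (s t : Monomial X) : Monomial X

/-- The underlying sequence of indeterminates of a monomial. -/
def Monomial.vars {X : Type*} : Monomial X → List X
  | .var x => [x]
  | .op _ s t => s.vars ++ t.vars

/-- The value of a monomial in a space `A` with two bilinear operations `mul`. -/
def Monomial.eval {F A X : Type*} [Field F] [AddCommGroup A] [Module F A]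
    (mul : Op → A →ₗ[F] A →ₗ[F] A) (v : X → A) : Monomial X → A
  | .var x => v x
  | .op o s t => mul o (s.eval mul v) (t.eval mul v)

/-- The underlying space of the free algebra with two bilinear operations: the monomials
form a basis. -/
abbrev Poly (F X : Type*) [Field F] : Type _ := Monomial X →₀ F

namespace Poly

noncomputable section

variable {F X : Type*} [Field F]

/-- The indeterminate `x` as a polynomial. -/
def var (x : X) : Poly F X := Finsupp.single (Monomial.var x) 1

/-- The two operations of the free algebra: the bilinear extensions of
`(s, t) ↦ Monomial.op o s t`. -/
def mul (o : Op) : Poly F X →ₗ[F] Poly F X →ₗ[F] Poly F X :=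
  Finsupp.linearCombination F fun s => Finsupp.lmapDomain F F (Monomial.op o s)

/-- Evaluation of polynomials in a space `A` with two bilinear operations. -/
def eval {A : Type*} [AddCommGroup A] [Module F A]
    (mul : Op → A →ₗ[F] A →ₗ[F] A) (v : X → A) : Poly F X →ₗ[F] A :=
  Finsupp.linearCombination F (Monomial.eval mul v)

/-- A multilinear polynomial of degree `n`: in each monomial, each of the indeterminates
`0, 1, …, n - 1` occurs exactly once, and no other indeterminate occurs. -/
def IsMultilinear (n : ℕ) (f : Poly F ℕ) : Prop :=
  ∀ m ∈ f.support, m.vars.Perm (List.range n)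

end

end Poly

/-- `f` is a polynomial identity of the space `A` with the two bilinear operations `mul`:
every substitution of elements of `A` for the indeterminates gives `0`. -/
def IsIdentity {F A X : Type*} [Field F] [AddCommGroup A] [Module F A]
    (mul : Op → A →ₗ[F] A →ₗ[F] A) (f : Poly F X) : Prop :=
  ∀ v : X → A, Poly.eval mul v f = 0

/-- `f` is a consequence of the identities in `S`: it is obtained from elements of `S` by
substituting polynomials for the indeterminates, multiplying by polynomials on either side,
and forming linear combinations. -/
inductive IsConsequence {F X : Type*} [Field F] (S : Set (Poly F ℕ)) : Poly F X → Prop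
  | subst (g : Poly F ℕ) (hg : g ∈ S) (φ : ℕ → Poly F X) :
      IsConsequence S (Poly.eval Poly.mul φ g)
  | zero : IsConsequence S 0
  | add (f g : Poly F X) : IsConsequence S f → IsConsequence S g → IsConsequence S (f + g)
  | smul (c : F) (f : Poly F X) : IsConsequence S f → IsConsequence S (c • f)
  | mul_left (o : Op) (a f : Poly F X) : IsConsequence S f → IsConsequence S (Poly.mul o a f)
  | mul_right (o : Op) (f a : Poly F X) : IsConsequence S f → IsConsequence S (Poly.mul o f a)

noncomputable section

/-- The ideal of all consequences of `S` in the indeterminates `X`. -/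
def consequences {F : Type*} [Field F] (S : Set (Poly F ℕ)) (X : Type*) :
    Submodule F (Poly F X) where
  carrier := {f | IsConsequence S f}
  zero_mem' := .zero
  add_mem' := fun {f g} hf hg => .add f g hf hg
  smul_mem' := fun c f hf => .smul c f hf

/-- The free algebra on `X` in the variety defined by the identities in `S`. -/
abbrev FreeAlg {F : Type*} [Field F] (S : Set (Poly F ℕ)) (X : Type*) : Type _ :=
  Poly F X ⧸ consequences S X

/-- The two operations of the free algebra, induced by those on polynomials. -/
def FreeAlg.mul {F : Type*} [Field F] (S : Set (Poly F ℕ)) (X : Type*) (o : Op) :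
    FreeAlg S X →ₗ[F] FreeAlg S X →ₗ[F] FreeAlg S X :=
  (consequences S X).liftQ
    ((consequences S X).liftQ ((Poly.mul o).compr₂ (consequences S X).mkQ).flip
      (fun f hf => LinearMap.ext fun a => (Submodule.Quotient.mk_eq_zero (consequences S X)).2
        (IsConsequence.mul_left o a f hf))).flip
    (fun f hf => LinearMap.ext fun b => by
      obtain ⟨a, rfl⟩ := Submodule.Quotient.mk_surjective _ b
      exact (Submodule.Quotient.mk_eq_zero (consequences S X)).2
        (IsConsequence.mul_right o f a hf))

/-- `(x₀ * x₁) * x₂ - x₀ * (x₁ * x₂)` for the operation `o`. -/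
def associativity (F : Type*) [Field F] (o : Op) : Poly F ℕ :=
  Poly.mul o (Poly.mul o (Poly.var 0) (Poly.var 1)) (Poly.var 2) -
    Poly.mul o (Poly.var 0) (Poly.mul o (Poly.var 1) (Poly.var 2))

/-- `(x₀ ∘ x₁) • (x₂ ∘ x₃) - (x₀ • x₂) ∘ (x₁ • x₃)`. -/
def interchange (F : Type*) [Field F] : Poly F ℕ :=
  Poly.mul .bullet (Poly.mul .circ (Poly.var 0) (Poly.var 1))
      (Poly.mul .circ (Poly.var 2) (Poly.var 3)) -
    Poly.mul .circ (Poly.mul .bullet (Poly.var 0) (Poly.var 2))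
      (Poly.mul .bullet (Poly.var 1) (Poly.var 3))

/-- The defining identities of associative interchange algebras. -/
def assocInterchangeIdentities (F : Type*) [Field F] : Set (Poly F ℕ) :=
  {associativity F .circ, associativity F .bullet, interchange F}

/-- The free associative interchange algebra on `X`. -/
abbrev FreeAssocInterchange (F X : Type*) [Field F] : Type _ :=
  FreeAlg (assocInterchangeIdentities F) X

/-- The commutator brackets `[a, b]_o = a o b - b o a` of two bilinear operations. -/
def bracket {F A : Type*} [Field F] [AddCommGroup A] [Module F A]
    (mul : Op → A →ₗ[F] A →ₗ[F] A) (o : Op) : A →ₗ[F] A →ₗ[F] A :=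
  mul o - (mul o).flip

/-- The two Lie brackets of the free associative interchange algebra on `X`. -/
def lieBracket (F X : Type*) [Field F] :
    Op → FreeAssocInterchange F X →ₗ[F] FreeAssocInterchange F X →ₗ[F]
      FreeAssocInterchange F X :=
  bracket (FreeAlg.mul (assocInterchangeIdentities F) X)

/-- `[x₀, x₁] + [x₁, x₀]` for the operation `o`. -/
def anticommutativity (F : Type*) [Field F] (o : Op) : Poly F ℕ :=
  Poly.mul o (Poly.var 0) (Poly.var 1) + Poly.mul o (Poly.var 1) (Poly.var 0)

/-- `[x₀, [x₁, x₂]] + [x₁, [x₂, x₀]] + [x₂, [x₀, x₁]]` for the operation `o`. -/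
def jacobi (F : Type*) [Field F] (o : Op) : Poly F ℕ :=
  Poly.mul o (Poly.var 0) (Poly.mul o (Poly.var 1) (Poly.var 2)) +
    Poly.mul o (Poly.var 1) (Poly.mul o (Poly.var 2) (Poly.var 0)) +
    Poly.mul o (Poly.var 2) (Poly.mul o (Poly.var 0) (Poly.var 1))

/-- Anticommutativity and the Jacobi identity for each of the two operations. -/
def lieIdentities (F : Type*) [Field F] : Set (Poly F ℕ) :=
  {anticommutativity F .circ, anticommutativity F .bullet, jacobi F .circ, jacobi F .bullet}

end

end Interchange

namespace Interchange

noncomputable section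

/-! Replace the interchange algebra by the free space with two associative operations, whose basis
consists of the right-associated (`Reduced`) monomials, and let `expand` write a bracket monomial in
that basis. The theorem splits into two statements.

Expansion is injective modulo the Lie identities on multilinear polynomials. The left inverse
`recover` keeps only the monomials whose last factor, at every vertex, contains the least
indeterminate, and reads `x₁ ⋯ xₖ y` as `[x₁, [⋯, [xₖ, y]]]`. By the Jacobi identity, left
multiplication by an expanded Lie monomial then acts as its adjoint map, which gives
`recover_expand_aux`.

An identity of degree at most five expands to zero. The interchange law can be applied only to
`Crowded` monomials. Killing these yields an associative interchange algebra, so every other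
coefficient of the expansion vanishes (`expand_mem_crowdedSpan`). For crowded monomials, small
algebras of functions on dissected rectangles show that the coefficients over one interchange class
sum to zero (`RowPart.relations`, `ColumnPart.relation`). Reversing one operation changes the
coefficient of a product of `k` factors by `(-1)^(k-1)`. Comparing a relation with its reversal
separates its terms, up to division by `2`. In the column case one more family survives, and its
incompatible symmetries kill it (`eq_zero_of_symmetries`). Up to degree five these cases are
exhaustive. -/

instance : DecidableEq Op := fun a b => by
  cases a <;> cases b <;> first | exact isTrue rfl | exact isFalse nofun

/-! ### Evaluation of nonassociative polynomials -/

namespace Poly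

variable {F X : Type*} [Field F]

@[simp]
theorem mul_single (o : Op) (s t : Monomial X) (a b : F) :
    mul o (Finsupp.single s a) (Finsupp.single t b) = Finsupp.single (.op o s t) (a * b) := by
  simp [mul, Finsupp.linearCombination_single, -Finsupp.single_mul]

@[simp]
theorem eval_single {A : Type*} [AddCommGroup A] [Module F A]
    (m : Op → A →ₗ[F] A →ₗ[F] A) (v : X → A) (s : Monomial X) (a : F) :
    eval m v (Finsupp.single s a) = a • s.eval m v := by
  simp [eval, Finsupp.linearCombination_single]

@[simp]
theorem eval_var {A : Type*} [AddCommGroup A] [Module F A]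
    (m : Op → A →ₗ[F] A →ₗ[F] A) (v : X → A) (x : X) : eval m v (var x) = v x := by
  simp [var, Monomial.eval]

@[simp]
theorem eval_mul {A : Type*} [AddCommGroup A] [Module F A]
    (m : Op → A →ₗ[F] A →ₗ[F] A) (v : X → A) (o : Op) (f g : Poly F X) :
    eval m v (mul o f g) = m o (eval m v f) (eval m v g) := by
  induction f using Finsupp.induction_linear with
  | zero => simp
  | add f₁ f₂ h₁ h₂ => simp [h₁, h₂]
  | single s a =>
    induction g using Finsupp.induction_linear with
    | zero => simp
    | add f₁ f₂ h₁ h₂ => simp [h₁, h₂]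
    | single t b => simp [Monomial.eval, smul_smul, mul_comm, -Finsupp.single_mul]

/-- Evaluation commutes with homomorphisms. -/
theorem map_eval {A B : Type*} [AddCommGroup A] [Module F A] [AddCommGroup B] [Module F B]
    (mA : Op → A →ₗ[F] A →ₗ[F] A) (mB : Op → B →ₗ[F] B →ₗ[F] B) (h : A →ₗ[F] B)
    (hh : ∀ o a b, h (mA o a b) = mB o (h a) (h b)) (v : X → A) (f : Poly F X) :
    h (eval mA v f) = eval mB (fun x => h (v x)) f := by
  have key : ∀ m : Monomial X, h (m.eval mA v) = m.eval mB (fun x => h (v x)) := by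
    intro m
    induction m with
    | var x => rfl
    | op o s t hs ht => simp [Monomial.eval, hh, hs, ht]
  induction f using Finsupp.induction_linear with
  | zero => simp
  | add f₁ f₂ h₁ h₂ => simp [h₁, h₂]
  | single s a => simp [key]

theorem eval_eval {A Y : Type*} [AddCommGroup A] [Module F A]
    (m : Op → A →ₗ[F] A →ₗ[F] A) (v : X → A) (φ : Y → Poly F X) (g : Poly F Y) :
    eval m v (eval mul φ g) = eval m (fun y => eval m v (φ y)) g :=
  map_eval (A := Poly F X) (B := A) mul m (eval m v) (eval_mul m v) φ g

end Poly

/-! ### Transfer of identities from the free algebra to all associative interchange algebras -/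

section Transfer

variable {F : Type*} [Field F]

@[simp]
theorem FreeAlg.mul_mk (S : Set (Poly F ℕ)) (X : Type*) (o : Op) (f g : Poly F X) :
    FreeAlg.mul S X o ((consequences S X).mkQ f) ((consequences S X).mkQ g) =
      (consequences S X).mkQ (Poly.mul o f g) := rfl

theorem eval_eq_zero_of_isConsequence {A X : Type*} [AddCommGroup A] [Module F A]
    (m : Op → A →ₗ[F] A →ₗ[F] A) {S : Set (Poly F ℕ)} (hS : ∀ g ∈ S, IsIdentity m g)
    (v : X → A) {f : Poly F X} (hf : IsConsequence S f) : Poly.eval m v f = 0 := by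
  induction hf with
  | subst g hg φ => rw [Poly.eval_eval]; exact hS g hg _
  | zero => simp
  | add f g _ _ h₁ h₂ => simp [h₁, h₂]
  | smul c f _ h => simp [h]
  | mul_left o a f _ h => simp [h]
  | mul_right o f a _ h => simp [h]

/-- An associative interchange algebra. -/
structure IsAssocInterchange {A : Type*} [AddCommGroup A] [Module F A]
    (m : Op → A →ₗ[F] A →ₗ[F] A) : Prop where
  assoc : ∀ o a b c, m o (m o a b) c = m o a (m o b c)
  interchange : ∀ a b c d, m .bullet (m .circ a b) (m .circ c d) =
    m .circ (m .bullet a c) (m .bullet b d)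

theorem IsAssocInterchange.isIdentity {A : Type*} [AddCommGroup A] [Module F A]
    {m : Op → A →ₗ[F] A →ₗ[F] A} (hm : IsAssocInterchange m) :
    ∀ g ∈ assocInterchangeIdentities F, IsIdentity m g := by
  rintro g (rfl | rfl | rfl) v
  · simp [associativity, hm.assoc]
  · simp [associativity, hm.assoc]
  · simp [Interchange.interchange, hm.interchange]

/-- An identity of the commutator brackets of the free associative interchange algebra holds for
the commutator brackets of every associative interchange algebra. -/
theorem IsAssocInterchange.isIdentity_bracket {A : Type*} [AddCommGroup A] [Module F A]
    {m : Op → A →ₗ[F] A →ₗ[F] A} (hm : IsAssocInterchange m) {f : Poly F ℕ}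
    (hf : IsIdentity (lieBracket F ℕ) f) : IsIdentity (bracket m) f := by
  intro v
  set S := assocInterchangeIdentities F
  -- Universal property: the homomorphism from the free algebra that sends the generator `x` to `v
  -- x`.
  let h : FreeAssocInterchange F ℕ →ₗ[F] A := (consequences S ℕ).liftQ (Poly.eval m v)
    (fun g hg => eval_eq_zero_of_isConsequence m hm.isIdentity v hg)
  have hmul : ∀ o a b, h (FreeAlg.mul S ℕ o a b) = m o (h a) (h b) := by
    intro o a b
    obtain ⟨a, rfl⟩ := Submodule.mkQ_surjective _ a
    obtain ⟨b, rfl⟩ := Submodule.mkQ_surjective _ b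
    rw [FreeAlg.mul_mk]
    exact Poly.eval_mul m v o a b
  have key := Poly.map_eval (lieBracket F ℕ) (bracket m) h
    (fun o a b => by simp [lieBracket, bracket, S, ← hmul])
    (fun x => (consequences S ℕ).mkQ (Poly.var x)) f
  rw [hf, map_zero] at key
  rw [key]
  congr 2
  funext x
  exact (Poly.eval_var m v x).symm

end Transfer

/-! ### Normal forms for two associative operations -/

namespace Monomial

variable {X : Type*}

/-- The outermost operation symbol is `o`. -/
def Rooted (o : Op) : Monomial X → Prop
  | .var _ => False
  | .op o' _ _ => o' = o

/-- Monomials modulo associativity of both operations are represented by the monomials that are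
associated to the right. -/
def Reduced : Monomial X → Prop
  | .var _ => True
  | .op o s t => s.Reduced ∧ t.Reduced ∧ ¬ s.Rooted o

/-- The product of reduced monomials modulo associativity. -/
def join (o : Op) : Monomial X → Monomial X → Monomial X
  | .var x, w => .op o (.var x) w
  | .op o' s t, w => if o' = o then .op o s (join o t w) else .op o (.op o' s t) w

theorem join_of_not_rooted {o : Op} {u : Monomial X} (hu : ¬ u.Rooted o) (w : Monomial X) :
    join o u w = .op o u w := by
  cases u with
  | var x => rfl
  | op o' s t => exact if_neg hu

@[simp]
theorem join_op_self (o : Op) (s t w : Monomial X) :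
    join o (.op o s t) w = .op o s (join o t w) := if_pos rfl

theorem rooted_join (o o' : Op) (u w : Monomial X) : (join o u w).Rooted o' ↔ o = o' := by
  cases u with
  | var x => rfl
  | op o₁ s t => unfold join; split_ifs <;> rfl

theorem join_assoc (o : Op) (u v w : Monomial X) :
    join o (join o u v) w = join o u (join o v w) := by
  induction u with
  | var x => simp [join]
  | op o' s t _ ht =>
    by_cases h : o' = o
    · subst h; simp [ht]
    · simp [join, h]

theorem vars_join (o : Op) (u w : Monomial X) : (join o u w).vars = u.vars ++ w.vars := by
  induction u with
  | var x => rfl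
  | op o' s t _ ht =>
    by_cases h : o' = o
    · subst h; simp [vars, ht]
    · simp [join, h, vars]

theorem Reduced.join {o : Op} {u w : Monomial X} (hu : u.Reduced) (hw : w.Reduced) :
    (join o u w).Reduced := by
  induction u with
  | var x => exact ⟨trivial, hw, id⟩
  | op o' s t _ ht =>
    by_cases h : o' = o
    · subst h
      rw [join_op_self]
      exact ⟨hu.1, ht hu.2.1, hu.2.2⟩
    · rw [join_of_not_rooted (show ¬ (op o' s t).Rooted o from h)]
      exact ⟨hu, hw, h⟩

/-- A cut of the product of `x` and `y`, with `x` a single factor, falls either directly after `x`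
or later. In the second case, deleting `x` leaves a cut of `y`. -/
theorem join_eq_op_iff {o : Op} {x : Monomial X} (hx : ¬ x.Rooted o) (u w y : Monomial X) :
    join o u w = .op o x y ↔
      (u = x ∧ w = y) ∨ ∃ u', u = .op o x u' ∧ join o u' w = y := by
  by_cases hu : u.Rooted o
  · cases u with
    | var z => exact hu.elim
    | op o' s t =>
      obtain rfl : o' = o := hu
      simp only [join_op_self, op.injEq, true_and]
      constructor
      · rintro ⟨rfl, h⟩; exact .inr ⟨t, ⟨rfl, rfl⟩, h⟩
      · rintro (⟨h, -⟩ | ⟨u', ⟨rfl, rfl⟩, h⟩)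
        · subst h; exact (hx rfl).elim
        · exact ⟨rfl, h⟩
  · rw [join_of_not_rooted hu]
    simp only [op.injEq, true_and]
    constructor
    · exact .inl
    · rintro (h | ⟨u', rfl, -⟩)
      · exact h
      · exact (hu rfl).elim

/-- The least indeterminate of a monomial. -/
def minVar : Monomial ℕ → ℕ
  | .var x => x
  | .op _ s t => min s.minVar t.minVar

theorem minVar_mem_vars (m : Monomial ℕ) : m.minVar ∈ m.vars := by
  induction m with
  | var x => simp [minVar, vars]
  | op o s t hs ht =>
    rcases min_choice s.minVar t.minVar with h | h <;> simp [minVar, vars, h, hs, ht]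

theorem minVar_join (o : Op) (u w : Monomial ℕ) :
    (join o u w).minVar = min u.minVar w.minVar := by
  induction u with
  | var x => rfl
  | op o' s t _ ht =>
    by_cases h : o' = o
    · subst h; simp [minVar, ht, min_assoc]
    · simp [join, h, minVar]

end Monomial

/-! ### The free algebra with two associative operations, and the expansion of brackets -/

namespace Poly

variable {F X : Type*} [Field F]

/-- The two products of the free algebra with two associative operations, in terms of reduced
monomials. -/
def joinMul (o : Op) : Poly F X →ₗ[F] Poly F X →ₗ[F] Poly F X :=
  Finsupp.linearCombination F fun s => Finsupp.lmapDomain F F (Monomial.join o s)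

@[simp]
theorem joinMul_single (o : Op) (s t : Monomial X) (a b : F) :
    joinMul o (Finsupp.single s a) (Finsupp.single t b) =
      Finsupp.single (Monomial.join o s t) (a * b) := by
  simp [joinMul, Finsupp.linearCombination_single]

theorem joinMul_assoc (o : Op) (f g h : Poly F X) :
    joinMul o (joinMul o f g) h = joinMul o f (joinMul o g h) := by
  induction f using Finsupp.induction_linear with
  | zero => simp
  | add f₁ f₂ h₁ h₂ => simp [h₁, h₂]
  | single s a =>
    induction g using Finsupp.induction_linear with
    | zero => simp
    | add f₁ f₂ h₁ h₂ => simp [h₁, h₂]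
    | single t b =>
      induction h using Finsupp.induction_linear with
      | zero => simp
      | add f₁ f₂ h₁ h₂ => rw [map_add, h₁, h₂, map_add, map_add]
      | single u c => simp [Monomial.join_assoc, mul_assoc, -Finsupp.single_mul]

theorem joinMul_mem_supported {o : Op} {f g : Poly F X} {s t u : Set (Monomial X)}
    (hf : f ∈ Finsupp.supported F F s) (hg : g ∈ Finsupp.supported F F t)
    (h : ∀ x ∈ s, ∀ y ∈ t, Monomial.join o x y ∈ u) :
    joinMul o f g ∈ Finsupp.supported F F u := by
  rw [Finsupp.supported_eq_span_single] at hf hg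
  induction hf, hg using Submodule.span_induction₂ with
  | mem_mem x y hx hy =>
    obtain ⟨x, hx, rfl⟩ := hx
    obtain ⟨y, hy, rfl⟩ := hy
    rw [joinMul_single]
    exact Finsupp.single_mem_supported F _ (h x hx y hy)
  | zero_left => simp
  | zero_right => simp
  | add_left x y z _ _ _ h₁ h₂ => rw [map_add]; exact add_mem h₁ h₂
  | add_right x y z _ _ _ h₁ h₂ => rw [map_add]; exact add_mem h₁ h₂
  | smul_left r x y _ _ h => rw [map_smul]; exact Submodule.smul_mem _ r h
  | smul_right r x y _ _ h => rw [map_smul]; exact Submodule.smul_mem _ r h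

end Poly

/-- The expansion of a monomial in the commutator brackets, in reduced monomials. -/
def expand (F : Type*) {X : Type*} [Field F] (m : Monomial X) : Poly F X :=
  m.eval (bracket Poly.joinMul) Poly.var

section Expand

variable {F X : Type*} [Field F]

theorem expand_op (o : Op) (s t : Monomial X) :
    expand F (.op o s t) =
      Poly.joinMul o (expand F s) (expand F t) - Poly.joinMul o (expand F t) (expand F s) :=
  rfl

/-- Both terms of a commutator multiply the same two factors, so all four properties pass through
the induction. The content and reducedness bound the monomials of an expansion; the least
indeterminate and the outermost symbol govern how `recover` acts on it. -/
theorem expand_mem_supported (m : Monomial ℕ) :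
    expand F m ∈ Finsupp.supported F F {T : Monomial ℕ | T.vars.Perm m.vars ∧ T.Reduced ∧
      T.minVar = m.minVar ∧ ∀ o, T.Rooted o ↔ m.Rooted o} := by
  induction m with
  | var x =>
    exact Finsupp.single_mem_supported F _ ⟨.refl _, trivial, rfl, fun _ => Iff.rfl⟩
  | op o s t hs ht =>
    rw [expand_op]
    refine sub_mem (Poly.joinMul_mem_supported hs ht ?_) (Poly.joinMul_mem_supported ht hs ?_)
    · rintro x ⟨h₁, h₂, h₃, -⟩ y ⟨k₁, k₂, k₃, -⟩
      refine ⟨?_, h₂.join k₂, ?_, fun o' => Monomial.rooted_join _ _ _ _⟩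
      · rw [Monomial.vars_join]; exact h₁.append k₁
      · rw [Monomial.minVar_join, h₃, k₃]; rfl
    · rintro x ⟨h₁, h₂, h₃, -⟩ y ⟨k₁, k₂, k₃, -⟩
      refine ⟨?_, h₂.join k₂, ?_, fun o' => Monomial.rooted_join _ _ _ _⟩
      · rw [Monomial.vars_join]; exact (h₁.append k₁).trans List.perm_append_comm
      · rw [Monomial.minVar_join, h₃, k₃, min_comm]; rfl

end Expand

/-! ### Recovering a Lie polynomial from its expansion -/

section Recover

variable (F : Type*) [Field F]

/-- The free algebra with two Lie brackets. -/
abbrev FreeLie : Type _ := FreeAlg (lieIdentities F) ℕ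

/-- The two Lie brackets of the free algebra. -/
abbrev FreeLie.br (o : Op) : FreeLie F →ₗ[F] FreeLie F →ₗ[F] FreeLie F :=
  FreeAlg.mul (lieIdentities F) ℕ o

theorem FreeLie.br_add_swap (o : Op) (a b : FreeLie F) : br F o a b + br F o b a = 0 := by
  obtain ⟨a, rfl⟩ := Submodule.mkQ_surjective _ a
  obtain ⟨b, rfl⟩ := Submodule.mkQ_surjective _ b
  have h : anticommutativity F o ∈ lieIdentities F := by cases o <;> simp [lieIdentities]
  have := IsConsequence.subst (X := ℕ) _ h (fun n => if n = 0 then a else b)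
  simp only [anticommutativity, map_add, Poly.eval_mul, Poly.eval_var] at this
  exact (Submodule.Quotient.mk_eq_zero _).2 this

theorem FreeLie.br_jacobi (o : Op) (a b c : FreeLie F) :
    br F o a (br F o b c) + br F o b (br F o c a) + br F o c (br F o a b) = 0 := by
  obtain ⟨a, rfl⟩ := Submodule.mkQ_surjective _ a
  obtain ⟨b, rfl⟩ := Submodule.mkQ_surjective _ b
  obtain ⟨c, rfl⟩ := Submodule.mkQ_surjective _ c
  have h : jacobi F o ∈ lieIdentities F := by cases o <;> simp [lieIdentities]
  have := IsConsequence.subst (X := ℕ) _ h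
    (fun n => if n = 0 then a else if n = 1 then b else c)
  simp only [jacobi, map_add, Poly.eval_mul, Poly.eval_var] at this
  exact (Submodule.Quotient.mk_eq_zero _).2 this

theorem FreeLie.br_swap (o : Op) (a b : FreeLie F) : br F o a b = - br F o b a :=
  eq_neg_of_add_eq_zero_left (br_add_swap F o a b)

/-- The Jacobi identity as the statement that the adjoint map of a bracket is the commutator of
adjoint maps. -/
theorem FreeLie.br_br (o : Op) (a b c : FreeLie F) :
    br F o (br F o a b) c = br F o a (br F o b c) - br F o b (br F o a c) := by
  have h := br_jacobi F o a b c
  rw [br_swap F o c a, br_swap F o c, map_neg] at h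
  rw [← sub_eq_zero, ← neg_eq_zero, ← h]
  abel

/-- The class of a monomial in the free algebra with two Lie brackets. -/
def lieMonomial (m : Monomial ℕ) : FreeLie F :=
  (consequences (lieIdentities F) ℕ).mkQ (Finsupp.single m 1)

theorem lieMonomial_op (o : Op) (s t : Monomial ℕ) :
    lieMonomial F (.op o s t) = FreeLie.br F o (lieMonomial F s) (lieMonomial F t) := by
  rw [lieMonomial, lieMonomial, lieMonomial, FreeLie.br, FreeAlg.mul_mk, Poly.mul_single, one_mul]

/-- The Lie monomial of a reduced monomial in which, at every vertex, the last factor contains the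
least indeterminate; the other reduced monomials are sent to `0`. -/
def recoverMonomial : Monomial ℕ → FreeLie F
  | .var x => lieMonomial F (.var x)
  | .op o s t => if t.minVar < s.minVar then
      FreeLie.br F o (recoverMonomial s) (recoverMonomial t) else 0

/-- The linear extension of `recoverMonomial`. -/
def recover : Poly F ℕ →ₗ[F] FreeLie F := Finsupp.linearCombination F (recoverMonomial F)

theorem recover_single (m : Monomial ℕ) (a : F) :
    recover F (Finsupp.single m a) = a • recoverMonomial F m := by
  simp [recover, Finsupp.linearCombination_single]

/-- The last factor comes from `w` and so misses the least indeterminate, which makes the test in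
`recoverMonomial` fail at some vertex of the product. -/
theorem recoverMonomial_join_eq_zero (o : Op) (u w : Monomial ℕ) (h : u.minVar < w.minVar) :
    recoverMonomial F (Monomial.join o u w) = 0 := by
  induction u with
  | var x => exact if_neg (not_lt.2 h.le)
  | op o' s t _ ht =>
    by_cases ho : o' = o
    · subst ho
      rw [Monomial.join_op_self, recoverMonomial, Monomial.minVar_join]
      rcases lt_or_ge t.minVar w.minVar with h' | h'
      · rw [ht h', map_zero, ite_self]
      -- Here the tail has least indeterminate `w.minVar`, and the smaller one demanded by `h` must
      -- lie in `s`, so the test fails at this vertex.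
      · rw [if_neg]
        rw [min_eq_right h', not_lt]
        simp only [Monomial.minVar, min_lt_iff] at h
        omega
    · rw [Monomial.join_of_not_rooted (show ¬ (Monomial.op o' s t).Rooted o from ho)]
      exact if_neg (not_lt.2 h.le)

/-- Multiplicativity of a linear map on polynomials supported in `s` and `t` may be checked on
monomials. -/
theorem map_bilin_of_single {M X : Type*} [AddCommGroup M] [Module F M]
    (B : Poly F X →ₗ[F] Poly F X →ₗ[F] Poly F X) (C : M →ₗ[F] M →ₗ[F] M) (r : Poly F X →ₗ[F] M)
    {s t : Set (Monomial X)}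
    (h : ∀ x ∈ s, ∀ y ∈ t, r (B (Finsupp.single x 1) (Finsupp.single y 1)) =
      C (r (Finsupp.single x 1)) (r (Finsupp.single y 1)))
    {f g : Poly F X} (hf : f ∈ Finsupp.supported F F s) (hg : g ∈ Finsupp.supported F F t) :
    r (B f g) = C (r f) (r g) := by
  rw [Finsupp.supported_eq_span_single] at hf hg
  induction hf, hg using Submodule.span_induction₂ with
  | mem_mem x y hx hy =>
    obtain ⟨x, hx, rfl⟩ := hx
    obtain ⟨y, hy, rfl⟩ := hy
    exact h x hx y hy
  | zero_left => simp
  | zero_right => simp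
  | add_left x y z _ _ _ h₁ h₂ => simp [h₁, h₂]
  | add_right x y z _ _ _ h₁ h₂ => simp [h₁, h₂]
  | smul_left r x y _ _ h => simp [h]
  | smul_right r x y _ _ h => simp [h]

theorem recover_joinMul_eq_zero (o : Op) {k : ℕ} {f g : Poly F ℕ}
    (hf : f ∈ Finsupp.supported F F {T : Monomial ℕ | T.minVar = k})
    (hg : g ∈ Finsupp.supported F F {T : Monomial ℕ | k < T.minVar}) :
    recover F (Poly.joinMul o f g) = 0 := by
  refine map_bilin_of_single F (M := FreeLie F) (Poly.joinMul o) 0 (recover F) ?_ hf hg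
  intro x hx y hy
  have hxy : x.minVar < y.minVar := by simpa [hx.out] using hy
  rw [Poly.joinMul_single, recover_single,
    recoverMonomial_join_eq_zero F o x y hxy, smul_zero, LinearMap.zero_apply,
    LinearMap.zero_apply]

theorem recover_joinMul_of_not_rooted (o : Op) {k : ℕ} {f g : Poly F ℕ}
    (hf : f ∈ Finsupp.supported F F {T : Monomial ℕ | T.minVar = k ∧ ¬ T.Rooted o})
    (hg : g ∈ Finsupp.supported F F {T : Monomial ℕ | T.minVar < k}) :
    recover F (Poly.joinMul o f g) = FreeLie.br F o (recover F f) (recover F g) := by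
  refine map_bilin_of_single F (M := FreeLie F) (Poly.joinMul o) (FreeLie.br F o) (recover F)
    ?_ hf hg
  intro x hx y hy
  have hxy : y.minVar < x.minVar := by simpa [hx.1] using hy
  rw [Poly.joinMul_single, recover_single,
    recover_single, recover_single, Monomial.join_of_not_rooted hx.2, recoverMonomial,
    if_pos hxy, one_smul, one_smul, one_mul, one_smul]

/-- The second assertion strengthens the induction: left multiplication by the expansion of `m`
becomes the adjoint map of `m`, as long as the least indeterminate stays in the right factor. If the
outermost symbol of `m` is not `o`, each monomial of its expansion is a single `o`-factor and this
is the definition of `recoverMonomial`; otherwise it follows from `FreeLie.br_br`. -/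
theorem recover_expand_aux (m : Monomial ℕ) (hm : m.vars.Nodup) :
    recover F (expand F m) = lieMonomial F m ∧
    ∀ (o : Op) (g : Poly F ℕ),
      g ∈ Finsupp.supported F F {T : Monomial ℕ | T.minVar < m.minVar} →
      recover F (Poly.joinMul o (expand F m) g) =
        FreeLie.br F o (lieMonomial F m) (recover F g) := by
  have supp (m : Monomial ℕ) : expand F m ∈
      Finsupp.supported F F {T : Monomial ℕ | T.minVar = m.minVar} :=
    Finsupp.supported_mono (fun T hT => hT.2.2.1) (expand_mem_supported m)
  have of_not_rooted (m : Monomial ℕ) (h : recover F (expand F m) = lieMonomial F m) (o : Op)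
      (ho : ¬ m.Rooted o) (g : Poly F ℕ)
      (hg : g ∈ Finsupp.supported F F {T : Monomial ℕ | T.minVar < m.minVar}) :
      recover F (Poly.joinMul o (expand F m) g) =
        FreeLie.br F o (lieMonomial F m) (recover F g) := by
    rw [← h]
    refine recover_joinMul_of_not_rooted F o (k := m.minVar) ?_ hg
    exact Finsupp.supported_mono (fun T hT => And.intro hT.2.2.1 fun h => ho ((hT.2.2.2 o).1 h))
      (expand_mem_supported m)
  induction m with
  | var x =>
    have h : recover F (expand F (.var x)) = lieMonomial F (.var x) := by
      simp [expand, Monomial.eval, Poly.var, recover_single, recoverMonomial]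
    exact ⟨h, fun o => of_not_rooted _ h o id⟩
  | op o s t hs ht =>
    obtain ⟨hns, hnt, hdis⟩ := List.nodup_append.1 hm
    obtain ⟨hs₁, hs₂⟩ := hs hns
    obtain ⟨ht₁, ht₂⟩ := ht hnt
    have hne : s.minVar ≠ t.minVar := hdis _ s.minVar_mem_vars _ t.minVar_mem_vars
    have main : recover F (expand F (.op o s t)) = lieMonomial F (.op o s t) := by
      rw [expand_op, map_sub, lieMonomial_op]
      -- Of the two products in the commutator, `recover` keeps only the one whose right factor
      -- contains the least indeterminate.
      rcases lt_or_gt_of_ne hne with h | h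
      · rw [ht₂ o _ (Finsupp.supported_mono (fun T hT => ?_) (supp s)), hs₁,
          recover_joinMul_eq_zero F o (supp s) (Finsupp.supported_mono (fun T hT => ?_) (supp t)),
          zero_sub, ← FreeLie.br_swap]
        · simpa [hT.out] using h
        · simpa [hT.out] using h
      · rw [hs₂ o _ (Finsupp.supported_mono (fun T hT => ?_) (supp t)), ht₁,
          recover_joinMul_eq_zero F o (supp t) (Finsupp.supported_mono (fun T hT => ?_) (supp s)),
          sub_zero]
        · simpa [hT.out] using h
        · simpa [hT.out] using h
    refine ⟨main, fun o' g hg => ?_⟩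
    by_cases ho : o = o'
    · subst ho
      have hgs : g ∈ Finsupp.supported F F {T : Monomial ℕ | T.minVar < s.minVar} :=
        Finsupp.supported_mono (fun T hT => lt_of_lt_of_le hT.out (min_le_left _ _)) hg
      have hgt : g ∈ Finsupp.supported F F {T : Monomial ℕ | T.minVar < t.minVar} :=
        Finsupp.supported_mono (fun T hT => lt_of_lt_of_le hT.out (min_le_right _ _)) hg
      have hsg : Poly.joinMul o (expand F s) g ∈
          Finsupp.supported F F {T : Monomial ℕ | T.minVar < t.minVar} :=
        Poly.joinMul_mem_supported (supp s) hgt fun x _ y hy => by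
          simp only [Set.mem_ofPred_eq, Monomial.minVar_join]
          exact lt_of_le_of_lt (min_le_right _ _) hy
      have htg : Poly.joinMul o (expand F t) g ∈
          Finsupp.supported F F {T : Monomial ℕ | T.minVar < s.minVar} :=
        Poly.joinMul_mem_supported (supp t) hgs fun x _ y hy => by
          simp only [Set.mem_ofPred_eq, Monomial.minVar_join]
          exact lt_of_le_of_lt (min_le_right _ _) hy
      rw [expand_op, map_sub, LinearMap.sub_apply, map_sub, Poly.joinMul_assoc,
        Poly.joinMul_assoc, hs₂ o _ htg, ht₂ o _ hgt, ht₂ o _ hsg, hs₂ o _ hgs,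
        lieMonomial_op, FreeLie.br_br]
    · exact of_not_rooted _ main o' ho g hg

/-- A multilinear polynomial whose expansion vanishes is a consequence of the Lie identities. -/
theorem isConsequence_of_expand_eq_zero {n : ℕ} {f : Poly F ℕ} (hf : f.IsMultilinear n)
    (h : Finsupp.linearCombination F (expand F) f = 0) : IsConsequence (lieIdentities F) f := by
  have key : recover F (Finsupp.linearCombination F (expand F) f) =
      (consequences (lieIdentities F) ℕ).mkQ f := by
    conv_rhs => rw [← Finsupp.sum_single f]
    rw [Finsupp.linearCombination_apply, Finsupp.sum, Finsupp.sum, map_sum, map_sum]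
    refine Finset.sum_congr rfl fun m hm => ?_
    have hnd : m.vars.Nodup := (hf m hm).nodup_iff.2 List.nodup_range
    rw [map_smul, (recover_expand_aux F m hnd).1, lieMonomial, ← map_smul, Finsupp.smul_single,
      smul_eq_mul, mul_one]
  rw [h, map_zero] at key
  exact (Submodule.Quotient.mk_eq_zero _).1 key.symm

end Recover

/-! ### Coefficients of the expansion -/

section Coefficients

variable {F X : Type*} [Field F]

theorem Monomial.join_eq_op_iff_of_not_rooted {o : Op} {x y : Monomial X} (hx : ¬ x.Rooted o)
    (hy : ¬ y.Rooted o) (u w : Monomial X) : join o u w = .op o x y ↔ u = x ∧ w = y := by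
  rw [join_eq_op_iff hx, or_iff_left]
  rintro ⟨u', -, rfl⟩
  exact hy ((rooted_join o o u' w).2 rfl)

theorem Monomial.join_eq_op_op_iff {o : Op} {x y z : Monomial X} (hx : ¬ x.Rooted o)
    (hy : ¬ y.Rooted o) (hz : ¬ z.Rooted o) (u w : Monomial X) :
    join o u w = .op o x (.op o y z) ↔
      (u = x ∧ w = .op o y z) ∨ (u = .op o x y ∧ w = z) := by
  rw [join_eq_op_iff hx]
  refine or_congr_right ?_
  constructor
  · rintro ⟨u', rfl, h⟩
    rw [join_eq_op_iff_of_not_rooted hy hz] at h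
    exact ⟨by rw [h.1], h.2⟩
  · rintro ⟨rfl, rfl⟩
    exact ⟨y, rfl, (join_eq_op_iff_of_not_rooted hy hz _ _).2 ⟨rfl, rfl⟩⟩

namespace Poly

/-- Two bilinear forms on polynomials that agree on monomials are equal. -/
theorem bilin_induction {B C : Poly F X → Poly F X → F}
    (hB₀ : ∀ g, B 0 g = C 0 g) (hB₁ : ∀ f, B f 0 = C f 0)
    (hB₂ : ∀ f f' g, B f g = C f g → B f' g = C f' g → B (f + f') g = C (f + f') g)
    (hB₃ : ∀ f g g', B f g = C f g → B f g' = C f g' → B f (g + g') = C f (g + g'))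
    (h : ∀ s a t b, B (Finsupp.single s a) (Finsupp.single t b) =
      C (Finsupp.single s a) (Finsupp.single t b)) (f g : Poly F X) : B f g = C f g := by
  induction f using Finsupp.induction_linear with
  | zero => exact hB₀ g
  | add f₁ f₂ h₁ h₂ => exact hB₂ _ _ _ h₁ h₂
  | single s a =>
    induction g using Finsupp.induction_linear with
    | zero => exact hB₁ _
    | add f₁ f₂ h₁ h₂ => exact hB₃ _ _ _ h₁ h₂
    | single t b => exact h s a t b

theorem joinMul_apply_of_not_rooted {o : Op} {T : Monomial X} (hT : ¬ T.Rooted o)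
    (f g : Poly F X) : joinMul o f g T = 0 := by
  classical
  refine bilin_induction (B := fun f g => joinMul o f g T) (C := fun _ _ => 0)
    (by simp) (by simp) (by simp +contextual) (by simp +contextual) (fun s a t b => ?_) f g
  rw [joinMul_single, Finsupp.single_apply, if_neg]
  rintro rfl
  exact hT ((Monomial.rooted_join _ _ _ _).2 rfl)

theorem joinMul_apply_op {o : Op} {x y : Monomial X} (hx : ¬ x.Rooted o)
    (hy : ¬ y.Rooted o) (f g : Poly F X) : joinMul o f g (.op o x y) = f x * g y := by
  classical
  refine bilin_induction (B := fun f g => joinMul o f g (.op o x y)) (C := fun f g => f x * g y)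
    (by simp) (by simp) (by simp +contextual [add_mul]) (by simp +contextual [mul_add])
    (fun s a t b => ?_) f g
  simp only [joinMul_single, Finsupp.single_apply,
    Monomial.join_eq_op_iff_of_not_rooted hx hy, ite_and]
  split_ifs <;> simp

theorem joinMul_apply_op_op {o : Op} {x y z : Monomial X} (hx : ¬ x.Rooted o)
    (hy : ¬ y.Rooted o) (hz : ¬ z.Rooted o) (f g : Poly F X) :
    joinMul o f g (.op o x (.op o y z)) = f x * g (.op o y z) + f (.op o x y) * g z := by
  classical
  refine bilin_induction (B := fun f g => joinMul o f g (.op o x (.op o y z)))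
    (C := fun f g => f x * g (.op o y z) + f (.op o x y) * g z)
    (by simp) (by simp) (fun f f' g h h' => ?_) (fun f f' g h h' => ?_)
    (fun s a t b => ?_) f g
  · simp only [map_add, LinearMap.add_apply, Finsupp.add_apply, h, h']; ring
  · simp only [map_add, Finsupp.add_apply, h, h']; ring
  · simp only [joinMul_single, Finsupp.single_apply, Monomial.join_eq_op_op_iff hx hy hz]
    have hxy : Monomial.op o x y ≠ x := fun h => hx (h ▸ rfl)
    by_cases hs : s = x
    · by_cases ht : t = .op o y z <;> simp [hs, ht, hxy.symm]
    · by_cases hs' : s = .op o x y <;> by_cases ht : t = z <;> simp [hs, hs', ht, hxy]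

end Poly

/-- The coefficient of the reduced monomial `T` in the expansion of monomials. -/
def coeff (F : Type*) [Field F] (T m : Monomial X) : F := expand F m T

/-- The bracket on functions of monomials dual to the decomposition of a bracket into its
factors. -/
def cobracket (o : Op) (p q : Monomial X → F) : Monomial X → F
  | .var _ => 0
  | .op o' s t => if o' = o then p s * q t - p t * q s else 0

theorem cobracket_swap (o : Op) (p q : Monomial X → F) :
    cobracket o p q = - cobracket o q p := by
  funext m
  cases m with
  | var x => simp [cobracket]
  | op o' s t => simp only [cobracket, Pi.neg_apply]; split_ifs <;> ring

theorem cobracket_neg_left (o : Op) (p q : Monomial X → F) :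
    cobracket o (-p) q = - cobracket o p q := by
  funext m
  cases m with
  | var x => simp [cobracket]
  | op o' s t => simp only [cobracket, Pi.neg_apply]; split_ifs <;> ring

theorem cobracket_neg_right (o : Op) (p q : Monomial X → F) :
    cobracket o p (-q) = - cobracket o p q := by
  rw [cobracket_swap, cobracket_neg_left, cobracket_swap o q, neg_neg]

theorem cobracket_add_left (o : Op) (p p' q : Monomial X → F) :
    cobracket o (p + p') q = cobracket o p q + cobracket o p' q := by
  funext m
  cases m with
  | var x => simp [cobracket]
  | op o' s t => simp only [cobracket, Pi.add_apply]; split_ifs <;> ring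

theorem coeff_op {o : Op} {x y : Monomial X} (hx : ¬ x.Rooted o) (hy : ¬ y.Rooted o) :
    coeff F (.op o x y) = cobracket o (coeff F x) (coeff F y) := by
  funext m
  cases m with
  | var z => exact Finsupp.single_eq_of_ne nofun
  | op o' s t =>
    rw [coeff, expand_op, Finsupp.sub_apply, cobracket]
    split_ifs with h
    · subst h
      rw [Poly.joinMul_apply_op hx hy, Poly.joinMul_apply_op hx hy]; rfl
    · have : ¬ (Monomial.op o x y).Rooted o' := fun h' => h h'.symm
      rw [Poly.joinMul_apply_of_not_rooted this, Poly.joinMul_apply_of_not_rooted this, sub_zero]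

/-- A product of three factors has exactly two cuts. Longer products are not needed: a crowded
monomial of degree at most five has at most three factors at each level. -/
theorem coeff_op_op {o : Op} {x y z : Monomial X} (hx : ¬ x.Rooted o) (hy : ¬ y.Rooted o)
    (hz : ¬ z.Rooted o) :
    coeff F (.op o x (.op o y z)) =
      cobracket o (coeff F x) (cobracket o (coeff F y) (coeff F z)) +
      cobracket o (cobracket o (coeff F x) (coeff F y)) (coeff F z) := by
  rw [← coeff_op hx hy, ← coeff_op hy hz]
  funext m
  cases m with
  | var z => simp [cobracket, coeff, expand, Monomial.eval, Poly.var]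
  | op o' s t =>
    rw [coeff, expand_op, Finsupp.sub_apply, Pi.add_apply, cobracket, cobracket]
    split_ifs with h
    · subst h
      rw [Poly.joinMul_apply_op_op hx hy hz, Poly.joinMul_apply_op_op hx hy hz]
      simp only [coeff]
      ring
    · have : ¬ (Monomial.op o x (.op o y z)).Rooted o' := fun h' => h h'.symm
      rw [Poly.joinMul_apply_of_not_rooted this, Poly.joinMul_apply_of_not_rooted this]
      ring

theorem coeff_var_var [DecidableEq X] (x y : X) :
    coeff F (.var x) (.var y) = if y = x then 1 else 0 := by
  classical
  simp [coeff, expand, Monomial.eval, Poly.var, Finsupp.single_apply]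

theorem coeff_var_op (x : X) (o : Op) (s t : Monomial X) :
    coeff F (.var x) (.op o s t) = 0 := by
  rw [coeff, expand_op, Finsupp.sub_apply, Poly.joinMul_apply_of_not_rooted id,
    Poly.joinMul_apply_of_not_rooted id, sub_zero]

theorem linearCombination_expand_apply (f : Poly F X) (T : Monomial X) :
    Finsupp.linearCombination F (expand F) f T = Finsupp.linearCombination F (coeff F T) f := by
  simp [Finsupp.linearCombination_apply, Finsupp.sum, Finsupp.finsetSum_apply, coeff]

end Coefficients

/-! ### Monomials to which the interchange identity does not apply -/

namespace Monomial

variable {X : Type*}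

/-- The monomial is not an indeterminate. -/
def IsProduct : Monomial X → Prop
  | .var _ => False
  | .op _ _ _ => True

/-- The first factor with respect to the operation `o` is not an indeterminate. -/
def HeadIsProduct (o : Op) : Monomial X → Prop
  | .var _ => False
  | .op o' s _ => o' = o → s.IsProduct

/-- Some product has two adjacent factors that are not indeterminates. -/
def Crowded : Monomial X → Prop
  | .var _ => False
  | .op o s t => s.Crowded ∨ t.Crowded ∨ (s.IsProduct ∧ t.HeadIsProduct o)

theorem HeadIsProduct.join {o : Op} {u : Monomial X} (hu : u.HeadIsProduct o)
    (w : Monomial X) : (join o u w).HeadIsProduct o := by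
  cases u with
  | var x => exact hu.elim
  | op o' s t =>
    by_cases h : o' = o
    · subst h; rw [join_op_self]; exact hu
    · rw [join_of_not_rooted (show ¬ (op o' s t).Rooted o from h)]
      exact fun _ => trivial

theorem Crowded.join_left (o : Op) {u : Monomial X} (hu : u.Crowded) (w : Monomial X) :
    (join o u w).Crowded := by
  induction u with
  | var x => exact hu.elim
  | op o' s t _ ht =>
    by_cases h : o' = o
    · subst h
      rw [join_op_self]
      rcases hu with hu | hu | ⟨h₁, h₂⟩
      · exact .inl hu
      · exact .inr (.inl (ht hu))
      · exact .inr (.inr ⟨h₁, h₂.join w⟩)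
    · rw [join_of_not_rooted (show ¬ (op o' s t).Rooted o from h)]
      exact .inl hu

theorem Crowded.join_right (o : Op) (u : Monomial X) {w : Monomial X} (hw : w.Crowded) :
    (join o u w).Crowded := by
  induction u with
  | var x => exact .inr (.inl hw)
  | op o' s t _ ht =>
    by_cases h : o' = o
    · subst h
      rw [join_op_self]
      exact .inr (.inl ht)
    · rw [join_of_not_rooted (show ¬ (op o' s t).Rooted o from h)]
      exact .inr (.inl hw)

/-- Each argument has outermost symbol `o'`, hence is a single factor for `o`, and the two are
adjacent. Both sides of the interchange identity have this shape. -/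
theorem crowded_join_join {o o' : Op} (h : o ≠ o') (a b c d : Monomial X) :
    (join o (join o' a b) (join o' c d)).Crowded := by
  have key : ∀ u v : Monomial X, u.Rooted o' → v.Rooted o' → (join o u v).Crowded := by
    intro u v hu hv
    cases u with
    | var x => exact hu.elim
    | op o₁ s t =>
      obtain rfl : o₁ = o' := hu
      rw [join_of_not_rooted (show ¬ (op o₁ s t).Rooted o from h.symm)]
      cases v with
      | var x => exact hv.elim
      | op o₂ s' t' =>
        obtain rfl : o₂ = o₁ := hv
        -- `HeadIsProduct` holds vacuously: the right argument is not an `o`-product, so it is its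
        -- own first factor.
        exact .inr (.inr ⟨trivial, fun h' => (h h'.symm).elim⟩)
  exact key _ _ ((rooted_join _ _ _ _).2 rfl) ((rooted_join _ _ _ _).2 rfl)

end Monomial

section Uncrowded

variable (F X : Type*) [Field F]

/-- The span of the crowded monomials. -/
abbrev crowdedSpan : Submodule F (Poly F X) :=
  Finsupp.supported F F {T : Monomial X | T.Crowded}

variable {F X}

theorem joinMul_mem_crowdedSpan_left (o : Op) {f : Poly F X} (hf : f ∈ crowdedSpan F X)
    (g : Poly F X) : Poly.joinMul o f g ∈ crowdedSpan F X :=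
  Poly.joinMul_mem_supported (t := Set.univ) hf (by simp [Finsupp.supported_univ])
    fun _ hx y _ => Monomial.Crowded.join_left o hx y

theorem joinMul_mem_crowdedSpan_right (o : Op) (f : Poly F X) {g : Poly F X}
    (hg : g ∈ crowdedSpan F X) : Poly.joinMul o f g ∈ crowdedSpan F X :=
  Poly.joinMul_mem_supported (s := Set.univ) (by simp [Finsupp.supported_univ]) hg
    fun x _ _ hy => Monomial.Crowded.join_right o x hy

theorem joinMul_joinMul_mem_crowdedSpan {o o' : Op} (h : o ≠ o') (a b c d : Poly F X) :
    Poly.joinMul o (Poly.joinMul o' a b) (Poly.joinMul o' c d) ∈ crowdedSpan F X := by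
  have key : ∀ a b : Poly F X, Poly.joinMul o' a b ∈
      Finsupp.supported F F {T : Monomial X | ∃ u v, T = Monomial.join o' u v} := fun a b =>
    Poly.joinMul_mem_supported (s := Set.univ) (t := Set.univ) (by simp [Finsupp.supported_univ])
      (by simp [Finsupp.supported_univ]) fun x _ y _ => ⟨x, y, rfl⟩
  refine Poly.joinMul_mem_supported (key a b) (key c d) ?_
  rintro _ ⟨u, v, rfl⟩ _ ⟨u', v', rfl⟩
  exact Monomial.crowded_join_join h u v u' v'

variable (F X) in
/-- The products of reduced monomials modulo the crowded ones. -/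
def uncrowdedMul (o : Op) : (Poly F X ⧸ crowdedSpan F X) →ₗ[F]
    (Poly F X ⧸ crowdedSpan F X) →ₗ[F] (Poly F X ⧸ crowdedSpan F X) :=
  (crowdedSpan F X).liftQ
    ((crowdedSpan F X).liftQ ((Poly.joinMul o).compr₂ (crowdedSpan F X).mkQ).flip
      (fun _ hf => LinearMap.ext fun a => (Submodule.Quotient.mk_eq_zero _).2
        (joinMul_mem_crowdedSpan_right o a hf))).flip
    (fun f hf => LinearMap.ext fun b => by
      obtain ⟨a, rfl⟩ := Submodule.Quotient.mk_surjective _ b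
      exact (Submodule.Quotient.mk_eq_zero _).2 (joinMul_mem_crowdedSpan_left o hf a))

theorem uncrowdedMul_mk (o : Op) (f g : Poly F X) :
    uncrowdedMul F X o ((crowdedSpan F X).mkQ f) ((crowdedSpan F X).mkQ g) =
      (crowdedSpan F X).mkQ (Poly.joinMul o f g) := rfl

/-- Interchange holds trivially, because both of its sides are crowded and become zero. -/
theorem isAssocInterchange_uncrowdedMul : IsAssocInterchange (uncrowdedMul F X) where
  assoc o a b c := by
    obtain ⟨a, rfl⟩ := Submodule.mkQ_surjective _ a
    obtain ⟨b, rfl⟩ := Submodule.mkQ_surjective _ b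
    obtain ⟨c, rfl⟩ := Submodule.mkQ_surjective _ c
    simp only [uncrowdedMul_mk, Poly.joinMul_assoc]
  interchange a b c d := by
    obtain ⟨a, rfl⟩ := Submodule.mkQ_surjective _ a
    obtain ⟨b, rfl⟩ := Submodule.mkQ_surjective _ b
    obtain ⟨c, rfl⟩ := Submodule.mkQ_surjective _ c
    obtain ⟨d, rfl⟩ := Submodule.mkQ_surjective _ d
    have h₁ : Op.bullet ≠ Op.circ := nofun
    have key : ∀ {o o' : Op} (_ : o ≠ o') (a b c d : Poly F X), (crowdedSpan F X).mkQ
        (Poly.joinMul o (Poly.joinMul o' a b) (Poly.joinMul o' c d)) = 0 := fun h a b c d =>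
      (Submodule.Quotient.mk_eq_zero _).2 (joinMul_joinMul_mem_crowdedSpan h a b c d)
    rw [uncrowdedMul_mk, uncrowdedMul_mk, uncrowdedMul_mk, uncrowdedMul_mk, uncrowdedMul_mk,
      uncrowdedMul_mk, key h₁, key h₁.symm]

/-- The expansion of an identity is a combination of crowded monomials. -/
theorem expand_mem_crowdedSpan {f : Poly F ℕ} (hf : IsIdentity (lieBracket F ℕ) f) :
    Finsupp.linearCombination F (expand F) f ∈ crowdedSpan F ℕ := by
  have h := isAssocInterchange_uncrowdedMul.isIdentity_bracket hf
    (fun x => (crowdedSpan F ℕ).mkQ (Poly.var x))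
  rw [← Poly.map_eval (bracket Poly.joinMul) (bracket (uncrowdedMul F ℕ)) (crowdedSpan F ℕ).mkQ
    (fun o a b => map_sub (crowdedSpan F ℕ).mkQ (Poly.joinMul o a b) (Poly.joinMul o b a))] at h
  exact (Submodule.Quotient.mk_eq_zero _).1 h

end Uncrowded

/-! ### Algebras of functions on dissections -/

section Cuts

variable {F W : Type*} [Field F]

/-- The convolution products on functions on `W`, where `cuts o w` lists the decompositions of `w`
with respect to the operation `o`. -/
def cutMul (cuts : Op → W → List (W × W)) (o : Op) : (W → F) →ₗ[F] (W → F) →ₗ[F] (W → F) :=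
  LinearMap.mk₂ F (fun f g w => ((cuts o w).map fun p => f p.1 * g p.2).sum)
    (fun f f' g => by ext w; simp [add_mul, List.sum_map_add])
    (fun c f g => by ext w; simp [mul_assoc, List.sum_map_mul_left])
    (fun f g g' => by ext w; simp [mul_add, List.sum_map_add])
    (fun c f g => by ext w; simp [mul_left_comm, List.sum_map_mul_left])

theorem cutMul_apply (cuts : Op → W → List (W × W)) (o : Op) (f g : W → F) (w : W) :
    cutMul cuts o f g w = ((cuts o w).map fun p => f p.1 * g p.2).sum := rfl

/-- The values at `w` of the monomials in the commutator brackets. -/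
def cutCoeff (cuts : Op → W → List (W × W)) (v : ℕ → W → F) (w : W) (m : Monomial ℕ) : F :=
  m.eval (bracket (cutMul cuts)) v w

theorem cutCoeff_var (cuts : Op → W → List (W × W)) (v : ℕ → W → F) (w : W) (x : ℕ) :
    cutCoeff cuts v w (.var x) = v x w := rfl

theorem cutCoeff_op (cuts : Op → W → List (W × W)) (v : ℕ → W → F) (w : W) (o : Op)
    (s t : Monomial ℕ) : cutCoeff cuts v w (.op o s t) =
      ((cuts o w).map fun p => cutCoeff cuts v p.1 s * cutCoeff cuts v p.2 t).sum -
      ((cuts o w).map fun p => cutCoeff cuts v p.1 t * cutCoeff cuts v p.2 s).sum := rfl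

theorem linearCombination_cutCoeff_eq_zero {cuts : Op → W → List (W × W)}
    (h : IsAssocInterchange (cutMul (F := F) cuts)) {f : Poly F ℕ}
    (hf : IsIdentity (lieBracket F ℕ) f) (v : ℕ → W → F) (w : W) :
    Finsupp.linearCombination F (cutCoeff cuts v w) f = 0 := by
  have := congrFun (h.isIdentity_bracket hf v) w
  rw [Poly.eval, Finsupp.linearCombination_apply, Finsupp.sum, Finset.sum_apply] at this
  rw [Finsupp.linearCombination_apply, Finsupp.sum]
  exact this

/-- The parts of the dissection `e ∘ (a • b) ∘ (c • d)`. -/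
inductive RowPart : Type
  | a | b | c | d | e | ab | cd | ac | bd | eab | abcd | top

/-- The decompositions of the parts of `e ∘ (a • b) ∘ (c • d)`, where `o` plays the role
of `∘`. -/
def RowPart.cuts (o o' : Op) : RowPart → List (RowPart × RowPart)
  | .ab => if o' = o then [] else [(.a, .b)]
  | .cd => if o' = o then [] else [(.c, .d)]
  | .ac => if o' = o then [(.a, .c)] else []
  | .bd => if o' = o then [(.b, .d)] else []
  | .eab => if o' = o then [(.e, .ab)] else []
  | .abcd => if o' = o then [(.ab, .cd)] else [(.ac, .bd)]
  | .top => if o' = o then [(.e, .abcd), (.eab, .cd)] else []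
  | _ => []

/-- Associativity matches the two cuts of `top` after each is refined to `e`, `ab`, `cd`.
Interchange matches the two cuts of `abcd`, the only part divided in both directions. -/
theorem RowPart.isAssocInterchange (o : Op) :
    IsAssocInterchange (cutMul (F := F) (RowPart.cuts o)) where
  assoc o' f g h := by
    funext w
    cases o <;> cases o' <;> cases w <;> simp [cutMul_apply, RowPart.cuts] <;> ring
  interchange f g h k := by
    funext w
    cases o <;> cases w <;> simp [cutMul_apply, RowPart.cuts] <;> ring

/-- The indeterminates `xa`, …, `xe` as functions on `RowPart`. -/
def RowPart.label (xa xb xc xd xe x : ℕ) : RowPart → F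
  | .a => if x = xa then 1 else 0
  | .b => if x = xb then 1 else 0
  | .c => if x = xc then 1 else 0
  | .d => if x = xd then 1 else 0
  | .e => if x = xe then 1 else 0
  | _ => 0

/-- The parts of the dissection `(a • b • c) ∘ (d • e)`. -/
inductive ColumnPart : Type
  | a | b | c | d | e | ab | bc | abc | de | ad | ce | abd | bce | top

/-- The decompositions of the parts of `(a • b • c) ∘ (d • e)`, where `o` plays the role
of `∘`. -/
def ColumnPart.cuts (o o' : Op) : ColumnPart → List (ColumnPart × ColumnPart)
  | .ab => if o' = o then [] else [(.a, .b)]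
  | .bc => if o' = o then [] else [(.b, .c)]
  | .abc => if o' = o then [] else [(.a, .bc), (.ab, .c)]
  | .de => if o' = o then [] else [(.d, .e)]
  | .ad => if o' = o then [(.a, .d)] else []
  | .ce => if o' = o then [(.c, .e)] else []
  | .abd => if o' = o then [(.ab, .d)] else []
  | .bce => if o' = o then [(.bc, .e)] else []
  | .top => if o' = o then [(.abc, .de)] else [(.ad, .bce), (.abd, .ce)]
  | _ => []

/-- Associativity only concerns `abc`. Interchange at `top` matches the two cuts of `abc`, each
paired with the cut of `de`, with the two vertical cuts of the whole rectangle. -/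
theorem ColumnPart.isAssocInterchange (o : Op) :
    IsAssocInterchange (cutMul (F := F) (ColumnPart.cuts o)) where
  assoc o' f g h := by
    funext w
    cases o <;> cases o' <;> cases w <;> simp [cutMul_apply, ColumnPart.cuts] <;> ring
  interchange f g h k := by
    funext w
    cases o <;> cases w <;> simp [cutMul_apply, ColumnPart.cuts] <;> ring

/-- The indeterminates `xa`, …, `xe` as functions on `ColumnPart`. -/
def ColumnPart.label (xa xb xc xd xe x : ℕ) : ColumnPart → F
  | .a => if x = xa then 1 else 0
  | .b => if x = xb then 1 else 0
  | .c => if x = xc then 1 else 0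
  | .d => if x = xd then 1 else 0
  | .e => if x = xe then 1 else 0
  | _ => 0

/-- A part whose only decomposition is `(u, u')` with respect to `o`. -/
theorem cutCoeff_eq_cobracket {cuts : Op → W → List (W × W)} {v : ℕ → W → F} {w : W} (o : Op)
    {u u' : W} (hv : ∀ x, v x w = 0)
    (hc : ∀ o', cuts o' w = if o' = o then [(u, u')] else []) :
    cutCoeff cuts v w = cobracket o (cutCoeff cuts v u) (cutCoeff cuts v u') := by
  funext m
  cases m with
  | var x => rw [cutCoeff_var, hv, cobracket]
  | op o' s t =>
    rw [cutCoeff_op, hc, cobracket]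
    split_ifs <;> simp

/-- A part whose only decompositions are `(u, u')` and `(z, z')`. -/
theorem cutCoeff_eq_cobracket_add {cuts : Op → W → List (W × W)} {v : ℕ → W → F} {w : W}
    (o o₁ : Op) {u u' z z' : W} (hv : ∀ x, v x w = 0)
    (hc : ∀ o', cuts o' w =
      (if o' = o then [(u, u')] else []) ++ if o' = o₁ then [(z, z')] else []) :
    cutCoeff cuts v w = cobracket o (cutCoeff cuts v u) (cutCoeff cuts v u') +
      cobracket o₁ (cutCoeff cuts v z) (cutCoeff cuts v z') := by
  funext m
  cases m with
  | var x => simp [cutCoeff_var, hv, cobracket]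
  | op o' s t =>
    rw [cutCoeff_op, hc, Pi.add_apply, cobracket, cobracket]
    split_ifs <;> simp
    ring

theorem cutCoeff_eq_coeff_var {cuts : Op → W → List (W × W)} {v : ℕ → W → F} {w : W} {y : ℕ}
    (hv : ∀ x, v x w = if x = y then 1 else 0) (hc : ∀ o', cuts o' w = []) :
    cutCoeff cuts v w = coeff F (.var y) := by
  funext m
  cases m with
  | var x => rw [cutCoeff_var, hv, coeff_var_var]
  | op o' s t => simp [cutCoeff_op, hc, coeff_var_op]

end Cuts

/-! ### Relations between the coefficients of an identity -/

section Relations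

variable {F : Type*} [Field F] {f : Poly F ℕ}

/-- The value of a function of monomials on a polynomial. -/
def pairing (f : Poly F ℕ) : (Monomial ℕ → F) →ₗ[F] F where
  toFun p := Finsupp.linearCombination F p f
  map_add' p q := by
    simp [Finsupp.linearCombination_apply, Finsupp.sum, mul_add, Finset.sum_add_distrib]
  map_smul' c p := by
    simp [Finsupp.linearCombination_apply, Finsupp.sum, mul_left_comm, Finset.mul_sum]

theorem Op.eq_of_ne_of_ne {o o₁ o₂ : Op} (h₁ : o₁ ≠ o) (h₂ : o₂ ≠ o) : o₁ = o₂ := by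
  cases o <;> cases o₁ <;> cases o₂ <;> simp_all

/-- The identity is evaluated with each indeterminate sent to the indicator of its cell, and its
values are read at `abcd` and at `top`. Unfolding the cuts turns these values into sums of
coefficients over all monomials that describe the same dissection. -/
theorem RowPart.relations (hf : IsIdentity (lieBracket F ℕ) f) {o o' : Op} (ho : o' ≠ o)
    (xa xb xc xd xe : ℕ) (a b c d e : Monomial ℕ → F) (ha : a = coeff F (.var xa))
    (hb : b = coeff F (.var xb)) (hc : c = coeff F (.var xc)) (hd : d = coeff F (.var xd))
    (he : e = coeff F (.var xe)) :
    pairing f (cobracket o (cobracket o' a b) (cobracket o' c d) +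
      cobracket o' (cobracket o a c) (cobracket o b d)) = 0 ∧
    pairing f (cobracket o e (cobracket o (cobracket o' a b) (cobracket o' c d) +
        cobracket o' (cobracket o a c) (cobracket o b d)) +
      cobracket o (cobracket o e (cobracket o' a b)) (cobracket o' c d)) = 0 := by
  have other : ∀ o₁, o₁ ≠ o ↔ o₁ = o' := fun o₁ =>
    ⟨fun h => Op.eq_of_ne_of_ne h ho, fun h => h ▸ ho⟩
  have key := linearCombination_cutCoeff_eq_zero (RowPart.isAssocInterchange o) hf
    (RowPart.label xa xb xc xd xe)
  have h₁ := key .abcd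
  have h₂ := key .top
  have ea := cutCoeff_eq_coeff_var (cuts := RowPart.cuts o)
    (v := RowPart.label (F := F) xa xb xc xd xe) (w := .a) (fun _ => rfl) (fun _ => rfl)
  have eb := cutCoeff_eq_coeff_var (cuts := RowPart.cuts o)
    (v := RowPart.label (F := F) xa xb xc xd xe) (w := .b) (fun _ => rfl) (fun _ => rfl)
  have ec := cutCoeff_eq_coeff_var (cuts := RowPart.cuts o)
    (v := RowPart.label (F := F) xa xb xc xd xe) (w := .c) (fun _ => rfl) (fun _ => rfl)
  have ed := cutCoeff_eq_coeff_var (cuts := RowPart.cuts o)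
    (v := RowPart.label (F := F) xa xb xc xd xe) (w := .d) (fun _ => rfl) (fun _ => rfl)
  have ee := cutCoeff_eq_coeff_var (cuts := RowPart.cuts o)
    (v := RowPart.label (F := F) xa xb xc xd xe) (w := .e) (fun _ => rfl) (fun _ => rfl)
  have eab := cutCoeff_eq_cobracket (cuts := RowPart.cuts o)
    (v := RowPart.label (F := F) xa xb xc xd xe) (w := .ab) o' (fun _ => rfl)
    (fun o₁ => by simp only [RowPart.cuts, ← other, ite_not]; rfl)
  have ecd := cutCoeff_eq_cobracket (cuts := RowPart.cuts o)
    (v := RowPart.label (F := F) xa xb xc xd xe) (w := .cd) o' (fun _ => rfl)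
    (fun o₁ => by simp only [RowPart.cuts, ← other, ite_not]; rfl)
  have eac := cutCoeff_eq_cobracket (cuts := RowPart.cuts o)
    (v := RowPart.label (F := F) xa xb xc xd xe) (w := .ac) o (fun _ => rfl) (fun o₁ => rfl)
  have ebd := cutCoeff_eq_cobracket (cuts := RowPart.cuts o)
    (v := RowPart.label (F := F) xa xb xc xd xe) (w := .bd) o (fun _ => rfl) (fun o₁ => rfl)
  have eeab := cutCoeff_eq_cobracket (cuts := RowPart.cuts o)
    (v := RowPart.label (F := F) xa xb xc xd xe) (w := .eab) o (fun _ => rfl) (fun o₁ => rfl)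
  have eabcd := cutCoeff_eq_cobracket_add (cuts := RowPart.cuts o)
    (v := RowPart.label (F := F) xa xb xc xd xe) (w := .abcd) o o' (u := .ab) (u' := .cd)
    (z := .ac) (z' := .bd) (fun _ => rfl)
    (fun o₁ => by simp only [RowPart.cuts, ← other, ite_not]; split_ifs <;> rfl)
  have etop := cutCoeff_eq_cobracket_add (cuts := RowPart.cuts o)
    (v := RowPart.label (F := F) xa xb xc xd xe) (w := .top) o o (u := .e) (u' := .abcd)
    (z := .eab) (z' := .cd) (fun _ => rfl)
    (fun o₁ => by simp only [RowPart.cuts]; split_ifs <;> rfl)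
  rw [etop, eabcd, eeab, eab, ecd, eac, ebd, ea, eb, ec, ed, ee] at h₂
  rw [eabcd, eab, ecd, eac, ebd, ea, eb, ec, ed] at h₁
  subst ha hb hc hd he
  exact ⟨h₁, h₂⟩

/-- The same evaluation at `top`, which is dissected in three ways: as `(a • b • c) ∘ (d • e)`, `(a
∘ d) • ((b • c) ∘ e)` and `((a • b) ∘ d) • (c ∘ e)`, with `o` as `∘`. -/
theorem ColumnPart.relation (hf : IsIdentity (lieBracket F ℕ) f) {o o' : Op} (ho : o' ≠ o)
    (xa xb xc xd xe : ℕ) (a b c d e : Monomial ℕ → F) (ha : a = coeff F (.var xa))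
    (hb : b = coeff F (.var xb)) (hc : c = coeff F (.var xc)) (hd : d = coeff F (.var xd))
    (he : e = coeff F (.var xe)) :
    pairing f (cobracket o (cobracket o' a (cobracket o' b c) + cobracket o' (cobracket o' a b) c)
        (cobracket o' d e) +
      (cobracket o' (cobracket o a d) (cobracket o (cobracket o' b c) e) +
        cobracket o' (cobracket o (cobracket o' a b) d) (cobracket o c e))) = 0 := by
  have other : ∀ o₁, o₁ ≠ o ↔ o₁ = o' := fun o₁ =>
    ⟨fun h => Op.eq_of_ne_of_ne h ho, fun h => h ▸ ho⟩
  have h₁ := linearCombination_cutCoeff_eq_zero (ColumnPart.isAssocInterchange o) hf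
    (ColumnPart.label xa xb xc xd xe) .top
  have ea := cutCoeff_eq_coeff_var (cuts := ColumnPart.cuts o)
    (v := ColumnPart.label (F := F) xa xb xc xd xe) (w := .a) (fun _ => rfl) (fun _ => rfl)
  have eb := cutCoeff_eq_coeff_var (cuts := ColumnPart.cuts o)
    (v := ColumnPart.label (F := F) xa xb xc xd xe) (w := .b) (fun _ => rfl) (fun _ => rfl)
  have ec := cutCoeff_eq_coeff_var (cuts := ColumnPart.cuts o)
    (v := ColumnPart.label (F := F) xa xb xc xd xe) (w := .c) (fun _ => rfl) (fun _ => rfl)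
  have ed := cutCoeff_eq_coeff_var (cuts := ColumnPart.cuts o)
    (v := ColumnPart.label (F := F) xa xb xc xd xe) (w := .d) (fun _ => rfl) (fun _ => rfl)
  have ee := cutCoeff_eq_coeff_var (cuts := ColumnPart.cuts o)
    (v := ColumnPart.label (F := F) xa xb xc xd xe) (w := .e) (fun _ => rfl) (fun _ => rfl)
  have eab := cutCoeff_eq_cobracket (cuts := ColumnPart.cuts o)
    (v := ColumnPart.label (F := F) xa xb xc xd xe) (w := .ab) o' (fun _ => rfl)
    (fun o₁ => by simp only [ColumnPart.cuts, ← other, ite_not]; rfl)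
  have ebc := cutCoeff_eq_cobracket (cuts := ColumnPart.cuts o)
    (v := ColumnPart.label (F := F) xa xb xc xd xe) (w := .bc) o' (fun _ => rfl)
    (fun o₁ => by simp only [ColumnPart.cuts, ← other, ite_not]; rfl)
  have ede := cutCoeff_eq_cobracket (cuts := ColumnPart.cuts o)
    (v := ColumnPart.label (F := F) xa xb xc xd xe) (w := .de) o' (fun _ => rfl)
    (fun o₁ => by simp only [ColumnPart.cuts, ← other, ite_not]; rfl)
  have ead := cutCoeff_eq_cobracket (cuts := ColumnPart.cuts o)
    (v := ColumnPart.label (F := F) xa xb xc xd xe) (w := .ad) o (fun _ => rfl) (fun o₁ => rfl)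
  have ece := cutCoeff_eq_cobracket (cuts := ColumnPart.cuts o)
    (v := ColumnPart.label (F := F) xa xb xc xd xe) (w := .ce) o (fun _ => rfl) (fun o₁ => rfl)
  have eabd := cutCoeff_eq_cobracket (cuts := ColumnPart.cuts o)
    (v := ColumnPart.label (F := F) xa xb xc xd xe) (w := .abd) o (fun _ => rfl) (fun o₁ => rfl)
  have ebce := cutCoeff_eq_cobracket (cuts := ColumnPart.cuts o)
    (v := ColumnPart.label (F := F) xa xb xc xd xe) (w := .bce) o (fun _ => rfl) (fun o₁ => rfl)
  have eabc := cutCoeff_eq_cobracket_add (cuts := ColumnPart.cuts o)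
    (v := ColumnPart.label (F := F) xa xb xc xd xe) (w := .abc) o' o' (u := .a) (u' := .bc)
    (z := .ab) (z' := .c) (fun _ => rfl)
    (fun o₁ => by simp only [ColumnPart.cuts, ← other, ite_not]; split_ifs <;> rfl)
  have etop : cutCoeff (ColumnPart.cuts o) (ColumnPart.label (F := F) xa xb xc xd xe) .top =
      cobracket o (cutCoeff (ColumnPart.cuts o) (ColumnPart.label xa xb xc xd xe) .abc)
        (cutCoeff (ColumnPart.cuts o) (ColumnPart.label xa xb xc xd xe) .de) +
      (cobracket o' (cutCoeff (ColumnPart.cuts o) (ColumnPart.label xa xb xc xd xe) .ad)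
        (cutCoeff (ColumnPart.cuts o) (ColumnPart.label xa xb xc xd xe) .bce) +
      cobracket o' (cutCoeff (ColumnPart.cuts o) (ColumnPart.label xa xb xc xd xe) .abd)
        (cutCoeff (ColumnPart.cuts o) (ColumnPart.label xa xb xc xd xe) .ce)) := by
    funext m
    cases m with
    | var x => simp [cutCoeff_var, cobracket, ColumnPart.label]
    | op o₁ s t =>
      simp only [cutCoeff_op, Pi.add_apply, cobracket, ColumnPart.cuts, ← other, ite_not]
      split_ifs <;> simp
      ring
  rw [etop, eabc, eabd, ebce, eab, ebc, ede, ead, ece, ea, eb, ec, ed, ee] at h₁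
  subst ha hb hc hd he
  exact h₁

end Relations

/-! ### Vanishing of the expansion -/

section Vanishing

variable {F : Type*} [Field F]

/-- The coefficient of an indeterminate. -/
abbrev leaf (F : Type*) [Field F] (x : ℕ) : Monomial ℕ → F := coeff F (.var x)

variable {f : Poly F ℕ}

/-- The coefficient of a product of two products vanishes. -/
theorem pairing_square_eq_zero [CharZero F] (hf : IsIdentity (lieBracket F ℕ) f) {o o' : Op}
    (ho : o' ≠ o) (a b c d : ℕ) :
    pairing f (cobracket o (cobracket o' (leaf F a) (leaf F b))
      (cobracket o' (leaf F c) (leaf F d))) = 0 := by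
  have h (a b c d : ℕ) := (RowPart.relations hf ho a b c d 0 _ _ _ _ _ rfl rfl rfl rfl rfl).1
  have h₁ := h a b c d
  -- Reversing `o'` preserves the first term, where two signs cancel, and negates the second.
  have h₂ := h b a d c
  rw [map_add] at h₁ h₂
  rw [cobracket_swap o' (leaf F b) (leaf F a), cobracket_swap o' (leaf F d) (leaf F c),
    cobracket_neg_left, cobracket_neg_right, neg_neg,
    cobracket_swap o' (cobracket o (leaf F b) (leaf F d)), map_neg] at h₂
  have h2 : (2 : F) ≠ 0 := two_ne_zero
  apply mul_left_cancel₀ h2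
  linear_combination h₁ + h₂

/-- Reversing `o'` negates the term containing the inner `o'`-product of two `o`-products and fixes
the sum of the other two, so half the difference and half the sum of the relations vanish. -/
theorem pairing_row [CharZero F] (hf : IsIdentity (lieBracket F ℕ) f) {o o' : Op}
    (ho : o' ≠ o) (a b c d e : ℕ) :
    pairing f (cobracket o (leaf F e) (cobracket o' (cobracket o (leaf F a) (leaf F c))
      (cobracket o (leaf F b) (leaf F d)))) = 0 ∧
    pairing f (cobracket o (leaf F e) (cobracket o (cobracket o' (leaf F a) (leaf F b))
      (cobracket o' (leaf F c) (leaf F d)))) +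
    pairing f (cobracket o (cobracket o (leaf F e) (cobracket o' (leaf F a) (leaf F b)))
      (cobracket o' (leaf F c) (leaf F d))) = 0 := by
  have h (a b c d : ℕ) := (RowPart.relations hf ho a b c d e _ _ _ _ _ rfl rfl rfl rfl rfl).2
  have cobracket_add_right (p q q' : Monomial ℕ → F) :
      cobracket o p (q + q') = cobracket o p q + cobracket o p q' := by
    rw [cobracket_swap, cobracket_add_left, cobracket_swap o q, cobracket_swap o q', neg_add,
      neg_neg, neg_neg]
  have h₁ := h a b c d
  have h₂ := h b a d c
  rw [cobracket_add_right, map_add, map_add] at h₁ h₂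
  rw [cobracket_swap o' (leaf F b) (leaf F a), cobracket_swap o' (leaf F d) (leaf F c),
    cobracket_swap o' (cobracket o (leaf F b) (leaf F d))] at h₂
  simp only [cobracket_neg_left, cobracket_neg_right, neg_neg, map_neg] at h₂
  have h2 : (2 : F) ≠ 0 := two_ne_zero
  constructor <;> apply mul_left_cancel₀ h2
  · linear_combination h₁ - h₂
  · linear_combination h₁ + h₂

/-- A function of five arguments that is antisymmetric in two pairs of its arguments and invariant
under an element of order six vanishes. -/
theorem eq_zero_of_symmetries [CharZero F] {α : Type*} (H : α → α → α → α → α → F)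
    (h₁ : ∀ a b c d e, H d b c a e = - H a b c d e)
    (h₂ : ∀ a b c d e, H c a b e d = H a b c d e) (a b c d e : α) : H a b c d e = 0 := by
  -- The cube of the order-six symmetry is the transposition of the last two arguments. Conjugating
  -- the antisymmetry `h₁` by it, and so on, makes the first and fourth arguments symmetric as well
  -- as antisymmetric.
  have h45 (a b c d e : α) : H a b c e d = H a b c d e :=
    (h₂ b c a d e).trans ((h₂ c a b e d).trans (h₂ a b c d e))
  have h15 (a b c d e : α) : H e b c d a = H a b c d e := by
    rw [h₁ d b c e a, h45 d b c a e, h₁ a b c d e, neg_neg]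
  have h14 : H d b c a e = H a b c d e := by
    rw [← h45 d b c a e, h15 a b c e d, h45]
  have h2 : (2 : F) ≠ 0 := two_ne_zero
  apply mul_left_cancel₀ h2
  linear_combination h₁ a b c d e - h14

/-- Reversing `o'` negates `L`, from one sign of `d • e` and none of the triple product, but fixes
the difference of the two `H` terms. Hence `L` vanishes and `H` is invariant under a 3-cycle times a
transposition. It is also antisymmetric in `a` and `d`, so it vanishes too. -/
theorem pairing_column [CharZero F] (hf : IsIdentity (lieBracket F ℕ) f) {o o' : Op}
    (ho : o' ≠ o) (a b c d e : ℕ) :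
    pairing f (cobracket o (cobracket o' (leaf F a) (cobracket o' (leaf F b) (leaf F c)) +
      cobracket o' (cobracket o' (leaf F a) (leaf F b)) (leaf F c))
        (cobracket o' (leaf F d) (leaf F e))) = 0 ∧
    pairing f (cobracket o' (cobracket o (leaf F a) (leaf F d))
      (cobracket o (cobracket o' (leaf F b) (leaf F c)) (leaf F e))) = 0 := by
  have h (a b c d e : ℕ) := ColumnPart.relation hf ho a b c d e _ _ _ _ _ rfl rfl rfl rfl rfl
  let L (a b c d e : ℕ) := pairing f
    (cobracket o (cobracket o' (leaf F a) (cobracket o' (leaf F b) (leaf F c)) +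
      cobracket o' (cobracket o' (leaf F a) (leaf F b)) (leaf F c))
        (cobracket o' (leaf F d) (leaf F e)))
  let H (a b c d e : ℕ) := pairing f (cobracket o' (cobracket o (leaf F a) (leaf F d))
      (cobracket o (cobracket o' (leaf F b) (leaf F c)) (leaf F e)))
  have h₁ (a b c d e : ℕ) : L a b c d e + (H a b c d e - H c a b e d) = 0 := by
    have h' := h a b c d e
    rw [map_add, map_add, cobracket_swap o' _ (cobracket o (leaf F c) (leaf F e)), map_neg,
      ← sub_eq_add_neg] at h'
    exact h'
  have hL (a b c d e : ℕ) : L c b a e d = - L a b c d e := by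
    simp only [L]
    have flip (p q r : Monomial ℕ → F) :
        cobracket o' p (cobracket o' q r) = cobracket o' (cobracket o' r q) p := by
      rw [cobracket_swap, cobracket_swap o' q r, cobracket_neg_left, neg_neg]
    rw [cobracket_swap o' (leaf F e), cobracket_neg_right, map_neg, flip, flip (leaf F a),
      add_comm]
  have hH₁ (a b c d e : ℕ) : H d b c a e = - H a b c d e := by
    simp only [H]
    rw [cobracket_swap o (leaf F d), cobracket_neg_left, map_neg]
  have hH₂ (a b c d e : ℕ) : H a c b d e = - H a b c d e := by
    simp only [H]
    rw [cobracket_swap o' (leaf F c), cobracket_neg_left, cobracket_neg_right, map_neg]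
  have h2 : (2 : F) ≠ 0 := two_ne_zero
  have hL₀ : L a b c d e = 0 := by
    apply mul_left_cancel₀ h2
    linear_combination h₁ a b c d e - h₁ c b a e d + hL a b c d e - hH₂ a b c d e
      + hH₂ c a b e d
  have hH (a b c d e : ℕ) : H c a b e d = H a b c d e := by
    apply mul_left_cancel₀ h2
    linear_combination - h₁ a b c d e - h₁ c b a e d + hL a b c d e - hH₂ a b c d e
      + hH₂ c a b e d
  exact ⟨hL₀, eq_zero_of_symmetries H hH₁ hH a b c d e⟩

/-! ### Shapes of crowded monomials of small degree -/

namespace Monomial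

variable {X : Type*}

theorem exists_var_or_two_le (m : Monomial X) :
    (∃ x, m = .var x) ∨ (m.IsProduct ∧ 2 ≤ m.vars.length) := by
  have one_le (m : Monomial X) : 1 ≤ m.vars.length := by
    induction m with
    | var x => simp [vars]
    | op o s t hs ht => simp only [vars, List.length_append]; omega
  cases m with
  | var x => exact .inl ⟨x, rfl⟩
  | op o s t =>
    refine .inr ⟨trivial, ?_⟩
    have := one_le s
    have := one_le t
    simp only [vars, List.length_append]; omega

theorem one_le_length (m : Monomial X) : 1 ≤ m.vars.length := by
  rcases m.exists_var_or_two_le with ⟨x, rfl⟩ | ⟨-, h⟩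
  · exact le_rfl
  · omega

theorem IsProduct.two_le {m : Monomial X} (h : m.IsProduct) : 2 ≤ m.vars.length := by
  rcases m.exists_var_or_two_le with ⟨x, rfl⟩ | ⟨-, h⟩
  · exact h.elim
  · exact h

theorem HeadIsProduct.isProduct {o : Op} {m : Monomial X} (h : m.HeadIsProduct o) :
    m.IsProduct := by
  cases m with
  | var x => exact h
  | op => trivial

theorem exists_eq_var {m : Monomial X} (h : m.vars.length ≤ 1) : ∃ x, m = .var x := by
  rcases m.exists_var_or_two_le with h' | ⟨-, h'⟩
  · exact h'
  · omega

theorem IsProduct.exists_eq_op {m : Monomial X} (hm : m.IsProduct) (h : m.vars.length ≤ 2) :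
    ∃ o x y, m = .op o (.var x) (.var y) := by
  cases m with
  | var x => exact hm.elim
  | op o s t =>
    simp only [vars, List.length_append] at h
    have := s.one_le_length
    have := t.one_le_length
    obtain ⟨x, rfl⟩ := s.exists_eq_var (by omega)
    obtain ⟨y, rfl⟩ := t.exists_eq_var (by omega)
    exact ⟨o, x, y, rfl⟩

theorem Crowded.four_le {m : Monomial X} (hm : m.Crowded) : 4 ≤ m.vars.length := by
  induction m with
  | var x => exact hm.elim
  | op o s t hs ht =>
    simp only [vars, List.length_append]
    rcases hm with h | h | ⟨h₁, h₂⟩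
    · have := hs h; omega
    · have := ht h; omega
    · have := h₁.two_le; have := h₂.isProduct.two_le; omega

theorem Crowded.exists_eq {m : Monomial X} (hm : m.Crowded) (hr : m.Reduced)
    (h : m.vars.length ≤ 4) : ∃ o o' a b c d, o' ≠ o ∧
      m = .op o (.op o' (.var a) (.var b)) (.op o' (.var c) (.var d)) := by
  cases m with
  | var x => exact hm.elim
  | op o s t =>
    simp only [vars, List.length_append] at h
    have := s.one_le_length
    have := t.one_le_length
    rcases hm with h' | h' | ⟨h₁, h₂⟩
    · have := h'.four_le; omega
    · have := h'.four_le; omega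
    · have := h₁.two_le
      have := h₂.isProduct.two_le
      obtain ⟨o₁, a, b, rfl⟩ := h₁.exists_eq_op (by omega)
      obtain ⟨o₂, c, d, rfl⟩ := h₂.isProduct.exists_eq_op (by omega)
      -- If `o₂` were `o`, the first `o`-factor of the right argument would be the indeterminate
      -- `c`, contrary to `h₂`.
      obtain rfl : o₂ = o₁ := Op.eq_of_ne_of_ne (fun h => h₂ h) hr.2.2
      exact ⟨o, o₂, a, b, c, d, hr.2.2, rfl⟩

end Monomial

theorem coeff_pair {o o' : Op} (ho : o' ≠ o) (s t s' t' : Monomial ℕ) :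
    coeff F (.op o (.op o' s t) (.op o' s' t')) =
      cobracket o (coeff F (.op o' s t)) (coeff F (.op o' s' t')) :=
  coeff_op (x := .op o' s t) (y := .op o' s' t') ho ho

theorem coeff_op_var_var (o : Op) (a b : ℕ) :
    coeff F (.op o (.var a) (.var b)) = cobracket o (leaf F a) (leaf F b) :=
  coeff_op (x := .var a) (y := .var b) id id

theorem coeff_op_var {o o' : Op} (ho : o' ≠ o) (a : ℕ) (s t : Monomial ℕ) :
    coeff F (.op o (.var a) (.op o' s t)) = cobracket o (leaf F a) (coeff F (.op o' s t)) :=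
  coeff_op (x := .var a) (y := .op o' s t) id ho

theorem coeff_op_op_var {o o' : Op} (ho : o' ≠ o) (a : ℕ) (s t : Monomial ℕ) :
    coeff F (.op o (.op o' s t) (.var a)) = cobracket o (coeff F (.op o' s t)) (leaf F a) :=
  coeff_op (x := .op o' s t) (y := .var a) ho id

theorem pairing_coeff_pair_swap {o o' : Op} (ho : o' ≠ o) {s t s' t' : Monomial ℕ}
    (h : pairing f (coeff F (.op o (.op o' s t) (.op o' s' t'))) = 0) :
    pairing f (coeff F (.op o (.op o' s' t') (.op o' s t))) = 0 := by
  rw [coeff_pair ho] at h ⊢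
  rw [cobracket_swap, map_neg, h, neg_zero]

/-- The coefficients of `(p ∗ q) ∗ (d ∗ e)`, where one of `p`, `q` is a product. -/
theorem pairing_coeff_three_two [CharZero F] (hf : IsIdentity (lieBracket F ℕ) f) {o o' : Op}
    (ho : o' ≠ o) {s t : Monomial ℕ} (hr : (Monomial.op o' s t).Reduced)
    (h2 : 3 ≤ s.vars.length + t.vars.length) (h3 : s.vars.length + t.vars.length ≤ 3) (d e : ℕ) :
    pairing f (coeff F (.op o (.op o' s t) (.op o' (.var d) (.var e)))) = 0 := by
  have hs := s.one_le_length
  have ht := t.one_le_length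
  rw [coeff_pair ho, coeff_op_var_var]
  rcases s.exists_var_or_two_le with ⟨a, rfl⟩ | ⟨hsp, hs2⟩
  · rcases t.exists_var_or_two_le with ⟨b, rfl⟩ | ⟨htp, ht2⟩
    · simp [Monomial.vars] at h2
    · obtain ⟨o₁, b, c, rfl⟩ := htp.exists_eq_op (by omega)
      by_cases h : o₁ = o'
      · subst h
        rw [coeff_op_op (x := .var a) (y := .var b) (z := .var c) id id id]
        exact (pairing_column hf ho a b c d e).1
      -- This is the second column relation with the roles of the two operations exchanged.
      · obtain rfl : o = o₁ := Op.eq_of_ne_of_ne ho.symm h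
        rw [coeff_op_var h, coeff_op_var_var, cobracket_swap, cobracket_swap o' (leaf F a),
          cobracket_neg_right, neg_neg]
        exact (pairing_column hf ho.symm d b c e a).2
  · obtain ⟨o₁, a, b, rfl⟩ := hsp.exists_eq_op (by omega)
    obtain ⟨c, rfl⟩ := t.exists_eq_var (by omega)
    have h : o₁ ≠ o' := hr.2.2
    obtain rfl : o = o₁ := Op.eq_of_ne_of_ne ho.symm h
    rw [coeff_op_op_var h, coeff_op_var_var, cobracket_swap, map_neg, neg_eq_zero]
    exact (pairing_column hf ho.symm d a b e c).2

/-- The coefficients of an identity at the crowded monomials of degree at most five vanish. -/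
theorem pairing_coeff_of_crowded [CharZero F] (hf : IsIdentity (lieBracket F ℕ) f)
    {T : Monomial ℕ} (hr : T.Reduced) (hc : T.Crowded) (hl : T.vars.length ≤ 5) :
    pairing f (coeff F T) = 0 := by
  cases T with
  | var x => exact hc.elim
  | op o s t =>
    simp only [Monomial.vars, List.length_append] at hl
    have hs := s.one_le_length
    have ht := t.one_le_length
    rcases hc with h | h | ⟨h₁, h₂⟩
    · have := h.four_le
      obtain ⟨e, rfl⟩ := t.exists_eq_var (by omega)
      obtain ⟨o₁, o₂, a, b, c, d, h₁₂, rfl⟩ := h.exists_eq hr.1 (by omega)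
      have h₁ : o₁ ≠ o := hr.2.2
      obtain rfl : o = o₂ := Op.eq_of_ne_of_ne h₁.symm h₁₂
      rw [coeff_op_op_var h₁, coeff_pair h₁₂, coeff_op_var_var, coeff_op_var_var,
        cobracket_swap, map_neg, (pairing_row hf h₁ a c b d e).1, neg_zero]
    · have := h.four_le
      obtain ⟨e, rfl⟩ := s.exists_eq_var (by omega)
      obtain ⟨o₁, o₂, a, b, c, d, h₁₂, rfl⟩ := h.exists_eq hr.2.1 (by omega)
      by_cases h₁ : o₁ = o
      · subst h₁
        rw [coeff_op_op (x := .var e) (y := .op o₂ (.var a) (.var b))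
          (z := .op o₂ (.var c) (.var d)) id h₁₂ h₁₂, coeff_op_var_var, coeff_op_var_var, map_add]
        exact (pairing_row hf h₁₂ a b c d e).2
      · obtain rfl : o = o₂ := Op.eq_of_ne_of_ne (Ne.symm h₁) h₁₂
        rw [coeff_op_var h₁, coeff_pair h₁₂, coeff_op_var_var, coeff_op_var_var]
        exact (pairing_row hf h₁ a c b d e).1
    · have hs2 := h₁.two_le
      have ht2 := h₂.isProduct.two_le
      cases t with
      | var x => exact h₂.elim
      | op o₁ t₁ t₂ =>
        simp only [Monomial.vars, List.length_append] at hl ht2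
        have ht₁ := t₁.one_le_length
        have ht₂ := t₂.one_le_length
        by_cases ho : o₁ = o
        · subst ho
          have ht₁p := h₂ rfl
          have := ht₁p.two_le
          obtain ⟨o', a, b, rfl⟩ := h₁.exists_eq_op (by omega)
          obtain ⟨o₂, c, d, rfl⟩ := ht₁p.exists_eq_op (by omega)
          obtain ⟨e, rfl⟩ := t₂.exists_eq_var (by omega)
          have h' : o' ≠ o₁ := hr.2.2
          obtain rfl : o₂ = o' := Op.eq_of_ne_of_ne hr.2.1.2.2 h'
          rw [coeff_op_op (x := .op o₂ (.var a) (.var b)) (y := .op o₂ (.var c) (.var d))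
            (z := .var e) h' h' id, coeff_op_var_var, coeff_op_var_var, map_add]
          -- The row relation has the indeterminate `e` first. Reversing a product of three factors
          -- leaves its coefficient unchanged, which moves `e` to the end.
          have k₂ := (pairing_row hf h' c d a b e).2
          rw [cobracket_swap o₁ (cobracket o₂ (leaf F c) (leaf F d)), cobracket_neg_right,
            map_neg] at k₂
          rw [cobracket_swap o₁ (cobracket o₂ (leaf F c) (leaf F d)) (leaf F e),
            cobracket_swap o₁ (cobracket o₁ _ _) (leaf F e), cobracket_neg_right,
            cobracket_swap o₁ (cobracket o₂ (leaf F a) (leaf F b)) (cobracket o₁ _ _),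
            neg_neg, map_neg]
          linear_combination k₂
        · cases s with
          | var x => exact h₁.elim
          | op o' s₁ s₂ =>
            simp only [Monomial.vars, List.length_append] at hl hs2
            have h' : o' ≠ o := hr.2.2
            obtain rfl : o₁ = o' := Op.eq_of_ne_of_ne ho h'
            have hs₁ := s₁.one_le_length
            have hs₂ := s₂.one_le_length
            -- Two product factors of total degree at most five have degrees `(3, 2)`, `(2, 3)` or
            -- `(2, 2)`.
            by_cases hs3 : 3 ≤ s₁.vars.length + s₂.vars.length
            · obtain ⟨d, rfl⟩ := t₁.exists_eq_var (by omega)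
              obtain ⟨e, rfl⟩ := t₂.exists_eq_var (by omega)
              exact pairing_coeff_three_two hf ho hr.1 hs3 (by omega) d e
            · obtain ⟨d, rfl⟩ := s₁.exists_eq_var (by omega)
              obtain ⟨e, rfl⟩ := s₂.exists_eq_var (by omega)
              by_cases ht3 : 3 ≤ t₁.vars.length + t₂.vars.length
              · exact pairing_coeff_pair_swap ho
                  (pairing_coeff_three_two hf ho hr.2.1 ht3 (by omega) d e)
              · obtain ⟨a, rfl⟩ := t₁.exists_eq_var (by omega)
                obtain ⟨b, rfl⟩ := t₂.exists_eq_var (by omega)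
                rw [coeff_pair ho, coeff_op_var_var, coeff_op_var_var]
                exact pairing_square_eq_zero hf ho d e a b

/-- The expansion of a multilinear identity of degree at most five vanishes. -/
theorem expand_eq_zero_of_isIdentity [CharZero F] (hf : IsIdentity (lieBracket F ℕ) f) {n : ℕ}
    (hn : n ≤ 5) (hm : f.IsMultilinear n) : Finsupp.linearCombination F (expand F) f = 0 := by
  have hsupp : Finsupp.linearCombination F (expand F) f ∈
      Finsupp.supported F F {T : Monomial ℕ | T.Reduced ∧ T.vars.length ≤ 5} := by
    rw [Finsupp.linearCombination_apply]
    refine Submodule.sum_mem _ fun m hmf => Submodule.smul_mem _ _ ?_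
    refine Finsupp.supported_mono (fun T hT => ?_) (expand_mem_supported m)
    refine And.intro hT.2.1 ?_
    rw [hT.1.length_eq, (hm m hmf).length_eq, List.length_range]
    exact hn
  by_contra hne
  obtain ⟨T, hT⟩ := Finsupp.support_nonempty_iff.2 hne
  have h₁ := (Finsupp.mem_supported F _).1 hsupp hT
  have h₂ : T.Crowded := (Finsupp.mem_supported F _).1 (expand_mem_crowdedSpan hf) hT
  rw [Finsupp.mem_support_iff, linearCombination_expand_apply] at hT
  exact hT (pairing_coeff_of_crowded hf h₁.1 h₂ h₁.2)

end Vanishing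

end

end Interchange

theorem mainTheorem9 {F : Type*} [Field F] [CharZero F] (n : ℕ) (hn : n ≤ 5)
    (f : Interchange.Poly F ℕ) (hf : f.IsMultilinear n)
    (hid : Interchange.IsIdentity (Interchange.lieBracket F ℕ) f) :
    Interchange.IsConsequence (Interchange.lieIdentities F) f :=
  Interchange.isConsequence_of_expand_eq_zero F hf
    (Interchange.expand_eq_zero_of_isIdentity hid hn hf)
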